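/- Let $(M,\omega)$ be a compact smooth symplectic manifold of dimension $4$, with possibly empty smooth boundary, endowed with a Riemannian metric. Let $H\colon M\to\mathbb{R}$ be a $C^2$ function that is constant on each connected component of $\partial M$, let $X_H$ be its Hamiltonian vector field, $\omega(X_H,\cdot)=dH$, and let $\varphi_H^t$ be the flow of $X_H$. Let $\mathcal{E}$ be a regular energy surface, that is, a connected component of a level set $H^{-1}(e)$ on which $dH$ does not vanish. At a point $x$ with $dH(x)\neq 0$ put $N_x=(\mathbb{R}X_H(x))^\perp$ and $\mathcal{N}_x=N_x\cap\ker dH(x)$, and let $$\Phi_H^t(x)=\Pi_{\varphi_H^t(x)}\circ D\varphi_H^t(x)\colon \mathcal{N}_x\to\mathcal{N}_{\varphi_H^t(x)}$$ be the transversal linear Poincaré flow, where $\Pi_y\colon T_yM\to N_y$ is the orthogonal projection. Let $\Lambda\subset\mathcal{E}$ be a $\varphi_H^t$-invariant set (not necessarily closed) with a dominated splitting for $\Phi_H^t$: a continuous $\Phi_H^t$-invariant splitting $\mathcal{N}_\Lambda=\mathcal{N}^-_\Lambda\oplus\mathcal{N}^+_\Lambda$ into one-dimensional subbundles such that, for some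 $m\in\mathbb{N}$, $$\frac{\|\Phi_H^m(x)|_{\mathcal{N}^-_x}\|}{\|\Phi_H^m(x)|_{\mathcal{N}^+_x}\|}\le\frac12,\qquad x\in\Lambda.$$ Then $\overline\Lambda$ is a hyperbolic set for $\varphi_H^t$: it is a compact $\varphi_H^t$-invariant subset of an energy level set, without critical points of $H$, and there are $m\in\mathbb{N}$ and a $D\varphi_H^t$-invariant splitting $$T_xH^{-1}(e)=\ker dH(x)=E^+_x\oplus E^-_x\oplus\mathbb{R}X_H(x),\qquad x\in\overline\Lambda,$$ with $\|D\varphi_H^m(x)|_{E^-_x}\|\le\frac12$ and $\|D\varphi_H^{-m}(x)|_{E^+_x}\|\le\frac12$ for all $x\in\overline\Lambda$. -/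

import Mathlib

open scoped Manifold ContDiff Topology
open Bundle

noncomputable section

namespace HamiltonianDynamics

section Symplectic

variable {E : Type*} [NormedAddCommGroup E] [NormedSpace ℝ E]
  {A : Type*} [TopologicalSpace A] (I : ModelWithCorners ℝ E A)
  (M : Type*) [TopologicalSpace M] [ChartedSpace A M] [IsManifold I ∞ M]

/-- The manifolds modelled on `I` are the `4`-dimensional manifolds without boundary (the model
space is all of `ℝ⁴`) or with possibly empty boundary (the model space is a closed half-space). -/
def IsFourDimModel {A : Type*} [TopologicalSpace A]
    (I : ModelWithCorners ℝ (EuclideanSpace ℝ (Fin 4)) A) : Prop :=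
  Set.range I = Set.univ ∨ Set.range I = {y | 0 ≤ y 0}

/-- A symplectic form on `M`: a smooth, closed and nondegenerate `2`-form. -/
structure SymplecticForm where
  /-- The bilinear form on each tangent space. -/
  form (x : M) : TangentSpace I x →L[ℝ] TangentSpace I x →L[ℝ] ℝ
  alternating (x : M) (v : TangentSpace I x) : form x v v = 0
  nondegenerate (x : M) (u : TangentSpace I x) (h : ∀ v, form x u v = 0) : u = 0
  smooth : ContMDiff I (I.prod 𝓘(ℝ, E →L[ℝ] E →L[ℝ] ℝ)) ∞
    (fun x ↦ Bundle.TotalSpace.mk' (E →L[ℝ] E →L[ℝ] ℝ)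
      (E := fun x : M ↦ TangentSpace I x →L[ℝ] TangentSpace I x →L[ℝ] ℝ) x (form x))
  /-- `dΩ = 0`, written in the charts of `M`: if `Ω_{v,w}` denotes the value on the constant vector
  fields `v`, `w` of the form read in a chart, then `∂_u Ω_{v,w} + ∂_v Ω_{w,u} + ∂_w Ω_{u,v} = 0`. -/
  closed (x₀ : M) (y : E) (hy : y ∈ (extChartAt I x₀).target) (u v w : E) :
    let D (z : E) : E →L[ℝ] TangentSpace I ((extChartAt I x₀).symm z) :=
      mfderivWithin 𝓘(ℝ, E) I (extChartAt I x₀).symm (Set.range I) z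
    let coeff (a b : E) (z : E) : ℝ := form ((extChartAt I x₀).symm z) (D z a) (D z b)
    fderivWithin ℝ (coeff v w) (Set.range I) y u + fderivWithin ℝ (coeff w u) (Set.range I) y v
      + fderivWithin ℝ (coeff u v) (Set.range I) y w = 0

variable {I M}

/-- The differential `dH(x)` of a function `H : M → ℝ`, as a linear form on `T_x M`. -/
def differential (I : ModelWithCorners ℝ E A) {M : Type*} [TopologicalSpace M] [ChartedSpace A M]
    (H : M → ℝ) (x : M) : TangentSpace I x →L[ℝ] ℝ :=
  mfderiv I 𝓘(ℝ, ℝ) H x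

theorem SymplecticForm.exists_form_eq [FiniteDimensional ℝ E] (Ω : SymplecticForm I M) (x : M)
    (l : TangentSpace I x →L[ℝ] ℝ) : ∃ u : TangentSpace I x, ∀ v, Ω.form x u v = l v := by
  have : FiniteDimensional ℝ (TangentSpace I x) := inferInstanceAs (FiniteDimensional ℝ E)
  let B : TangentSpace I x →ₗ[ℝ] Module.Dual ℝ (TangentSpace I x) :=
    { toFun := fun u ↦ (Ω.form x u).toLinearMap
      map_add' := fun u v ↦ by ext; simp
      map_smul' := fun c u ↦ by ext; simp }
  have hinj : Function.Injective B := by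
    refine (injective_iff_map_eq_zero B).2 fun u hu ↦ Ω.nondegenerate x u fun v ↦ ?_
    exact LinearMap.congr_fun hu v
  have hsurj : Function.Surjective B :=
    (LinearMap.injective_iff_surjective_of_finrank_eq_finrank
      (Subspace.dual_finrank_eq (K := ℝ) (V := TangentSpace I x)).symm).1 hinj
  obtain ⟨u, hu⟩ := hsurj l.toLinearMap
  exact ⟨u, fun v ↦ LinearMap.congr_fun hu v⟩

/-- The Hamiltonian vector field `X_H`, determined by `Ω(X_H, ·) = dH`. -/
def hamiltonianVectorField [FiniteDimensional ℝ E] (Ω : SymplecticForm I M) (H : M → ℝ) (x : M) :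
    TangentSpace I x :=
  (Ω.exists_form_eq x (differential I H x)).choose

theorem form_hamiltonianVectorField [FiniteDimensional ℝ E] (Ω : SymplecticForm I M) (H : M → ℝ)
    (x : M) (v : TangentSpace I x) :
    Ω.form x (hamiltonianVectorField Ω H x) v = differential I H x v :=
  (Ω.exists_form_eq x (differential I H x)).choose_spec v

/-- `φ` is the flow of the vector field `X`: `φ⁰ = id` and `d/dt φᵗ = X ∘ φᵗ` for all times. -/
def IsFlowOf (X : (x : M) → TangentSpace I x) (φ : ℝ → M → M) : Prop :=
  ∀ x, φ 0 x = x ∧ IsMIntegralCurve (fun t ↦ φ t x) X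

/-- `Λ` is invariant under the flow `φ`. -/
def IsInvariantSet {M : Type*} (φ : ℝ → M → M) (Λ : Set M) : Prop :=
  ∀ t, ∀ x ∈ Λ, φ t x ∈ Λ

/-- `S` is a regular energy surface of `H`: a connected component of an energy level set that
contains no critical point of `H`. -/
def IsRegularEnergySurface (I : ModelWithCorners ℝ E A) {M : Type*} [TopologicalSpace M]
    [ChartedSpace A M] (H : M → ℝ) (S : Set M) : Prop :=
  ∃ e : ℝ, (∀ x, H x = e → differential I H x ≠ 0) ∧
    ∃ x, H x = e ∧ S = connectedComponentIn {y | H y = e} x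

/-- A Hamiltonian of class `C²`: a `C²` function that is constant on each connected component of
the boundary of `M`. -/
def IsHamiltonian (I : ModelWithCorners ℝ E A) {M : Type*} [TopologicalSpace M]
    [ChartedSpace A M] (H : M → ℝ) : Prop :=
  ContMDiff I 𝓘(ℝ, ℝ) 2 H ∧
    ∀ x ∈ I.boundary M, ∀ y ∈ connectedComponentIn (I.boundary M) x, H y = H x

/-- The tangent flow `Dφᵗ(x) : T_x M → T_{φᵗ(x)} M`. -/
def tangentFlow (I : ModelWithCorners ℝ E A) {M : Type*} [TopologicalSpace M] [ChartedSpace A M]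
    (φ : ℝ → M → M) (t : ℝ) (x : M) : TangentSpace I x →L[ℝ] TangentSpace I (φ t x) :=
  mfderiv I I (φ t) x

/-- The family of subspaces `V x ⊆ T_x M` is continuous on `Λ`: near each point of `Λ` it is spanned
by a frame of linearly independent vector fields that are continuous on `Λ`. -/
def IsContinuousSubbundleOn (V : (x : M) → Submodule ℝ (TangentSpace I x)) (Λ : Set M) : Prop :=
  ∀ x₀ ∈ Λ, ∃ U : Set M, IsOpen U ∧ x₀ ∈ U ∧
    ∃ (k : ℕ) (s : Fin k → (x : M) → TangentSpace I x),
      (∀ i, ContinuousOn (fun x ↦ (⟨x, s i x⟩ : TangentBundle I M)) (U ∩ Λ)) ∧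
      ∀ x ∈ U ∩ Λ, LinearIndependent ℝ (fun i ↦ s i x) ∧
        Submodule.span ℝ (Set.range fun i ↦ s i x) = V x

end Symplectic

section Riemannian

variable {E : Type*} [NormedAddCommGroup E] [NormedSpace ℝ E]
  {A : Type*} [TopologicalSpace A] {I : ModelWithCorners ℝ E A}
  {M : Type*} [TopologicalSpace M] [ChartedSpace A M] [IsManifold I ∞ M]
  [RiemannianBundle (fun x : M ↦ TangentSpace I x)]

/-- The fibre `N_x ∩ ker dH(x)`, where `N_x` is the orthogonal complement of `ℝ X(x)`. -/
def transversalFibre (H : M → ℝ) (X : (x : M) → TangentSpace I x) (x : M) :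
    Submodule ℝ (TangentSpace I x) :=
  (Submodule.span ℝ {X x})ᗮ ⊓ (differential I H x).ker

/-- The transversal linear Poincaré flow `Φᵗ(x) v = Π_{φᵗ(x)} (Dφᵗ(x) v)`, where `Π_y` is the
orthogonal projection of `T_y M` onto `N_y`. It is considered on vectors of the transversal fibre. -/
def transversalPoincareFlow (X : (x : M) → TangentSpace I x) (φ : ℝ → M → M) (t : ℝ) (x : M) :
    TangentSpace I x →L[ℝ] TangentSpace I (φ t x) :=
  ((Submodule.span ℝ {X (φ t x)})ᗮ).starProjection ∘L tangentFlow I φ t x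

/-- The operator norm of the restriction of a linear map `L` to a subspace `V`. -/
def normOn {x y : M} (L : TangentSpace I x →L[ℝ] TangentSpace I y)
    (V : Submodule ℝ (TangentSpace I x)) : ℝ :=
  ‖L ∘L V.subtypeL‖

/-- `Λ` is an invariant set on which `Nm ⊕ Np` is an `m`-dominated splitting, into two line bundles,
of the bundle of transversal fibres. -/
structure IsDominatedSplitting (H : M → ℝ) (X : (x : M) → TangentSpace I x) (φ : ℝ → M → M)
    (Λ : Set M) (m : ℕ) (Nm Np : (x : M) → Submodule ℝ (TangentSpace I x)) : Prop where
  invariant_set : IsInvariantSet φ Λ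
  finrank_minus : ∀ x ∈ Λ, Module.finrank ℝ (Nm x) = 1
  finrank_plus : ∀ x ∈ Λ, Module.finrank ℝ (Np x) = 1
  disjoint : ∀ x ∈ Λ, Disjoint (Nm x) (Np x)
  sup_eq : ∀ x ∈ Λ, Nm x ⊔ Np x = transversalFibre H X x
  invariant_minus : ∀ x ∈ Λ, ∀ t,
    (Nm x).map (transversalPoincareFlow X φ t x).toLinearMap = Nm (φ t x)
  invariant_plus : ∀ x ∈ Λ, ∀ t,
    (Np x).map (transversalPoincareFlow X φ t x).toLinearMap = Np (φ t x)
  continuous_minus : IsContinuousSubbundleOn Nm Λ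
  continuous_plus : IsContinuousSubbundleOn Np Λ
  dominated : ∀ x ∈ Λ, normOn (transversalPoincareFlow X φ m x) (Nm x) /
    normOn (transversalPoincareFlow X φ m x) (Np x) ≤ 1 / 2

/-- `Λ` has a dominated splitting for the transversal linear Poincaré flow. -/
def HasDominatedSplitting (H : M → ℝ) (X : (x : M) → TangentSpace I x) (φ : ℝ → M → M)
    (Λ : Set M) : Prop :=
  ∃ m Nm Np, IsDominatedSplitting H X φ Λ m Nm Np

/-- `Λ` is a hyperbolic set for the flow `φ` of `X`: it is compact, invariant, contained in an energy
level set and free of critical points, and the tangent spaces of the level set have an invariant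
splitting `T_x H⁻¹(e) = ker dH(x) = E⁺ ⊕ E⁻ ⊕ ℝ X(x)`, uniformly expanded and contracted. -/
structure IsHyperbolicSet (H : M → ℝ) (X : (x : M) → TangentSpace I x) (φ : ℝ → M → M)
    (Λ : Set M) : Prop where
  isCompact : IsCompact Λ
  invariant_set : IsInvariantSet φ Λ
  subset_level : ∃ e : ℝ, ∀ x ∈ Λ, H x = e
  regular : ∀ x ∈ Λ, differential I H x ≠ 0
  splitting : ∃ (m : ℕ) (Ep Em : (x : M) → Submodule ℝ (TangentSpace I x)), ∀ x ∈ Λ,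
    Disjoint (Ep x) (Em x) ∧
    Disjoint (Ep x ⊔ Em x) (Submodule.span ℝ {X x}) ∧
    Ep x ⊔ Em x ⊔ Submodule.span ℝ {X x} = (differential I H x).ker ∧
    (∀ t, (Ep x).map (tangentFlow I φ t x).toLinearMap = Ep (φ t x)) ∧
    (∀ t, (Em x).map (tangentFlow I φ t x).toLinearMap = Em (φ t x)) ∧
    normOn (tangentFlow I φ m x) (Em x) ≤ 1 / 2 ∧
    normOn (tangentFlow I φ (-m) x) (Ep x) ≤ 1 / 2

end Riemannian

end HamiltonianDynamics

end

noncomputable section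

namespace HamiltonianDynamics

/-! ### Linear and variational differential equations on short time intervals -/

section ODE

open Set Filter

/-! The flow preserves `Ω` and `dH`, and `Ω(X, ·) = dH` vanishes on `ker dH`. Hence the transversal
linear Poincaré flow `Φ` preserves the area form that `Ω` induces on the two-dimensional fibres `𝒩`
(`form_transversalPoincareFlow`). Take `u ∈ 𝒩⁻` and `w ∈ 𝒩⁺`. The area spanned by their images under
`Φ` is constant in time, and it is comparable to the product of the norms, uniformly over `closure
Λ` (`exists_norm_mul_norm_le_form`). So `‖Φu‖ ‖Φw‖` is bounded above and below along the orbit,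
while domination makes `‖Φu‖ / ‖Φw‖` decay geometrically. Therefore `u` is contracted in the future
and `w` in the past (`sq_le_of_domination`, `exists_decay`).

To pass from `Φ` to the tangent flow, `u` is corrected by a multiple of `X`. The `X`-coordinate of
`Dφᵗ u` changes by amounts controlled by `‖Φᵗ u‖`, so along multiples of `m` it converges to some
`L`, and `u - L X` is contracted by `Dφ` (`exists_isContracted_of_decay`). Time reversal treats `w`.

Contraction with fixed constants is a family of closed homogeneous inequalities, so contracted
vectors exist over the closure too, by compactness of the unit sphere
(`exists_isContracted_of_mem_closure`). There a future-contracted vector, a past-contracted vector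
and `X` are independent and span `ker dH`. The vectors of `ker dH` that tend to zero thus form
exactly the line of the contracted vector (`stableSpace_eq_span`). This description is intrinsic,
which gives invariance.

The analytic input is that each `φᵗ` is a symplectic `C¹` map, also at the boundary of `M`. In a
chart, `X` is `C¹` up to the boundary, the variational equation gives the derivative of the flow,
and `dΩ = 0` with the symmetry of `D²H` makes the Lie derivative of `Ω` vanish. The local statement
is globalised by compactness and the group law. -/

theorem hasDerivWithinAt_Ici_of_Icc {F : Type*} [NormedAddCommGroup F] [NormedSpace ℝ F]
    {r : ℝ → F} {r' : F} {τ t : ℝ} (ht : t ∈ Ico 0 τ) (h : HasDerivWithinAt r r' (Icc 0 τ) t) :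
    HasDerivWithinAt r r' (Ici t) t :=
  h.mono_of_mem_nhdsWithin
    (mem_of_superset (Icc_mem_nhdsGE ht.2) (Icc_subset_Icc_left ht.1))

/-- Grönwall's inequality on a short time interval. -/
theorem norm_le_of_norm_deriv_le {F : Type*} [NormedAddCommGroup F] [NormedSpace ℝ F]
    {r r' : ℝ → F} {τ L δ ε : ℝ} (hL : 1 ≤ L) (hτ : L * τ ≤ 1 / 2) (hδ : 0 ≤ δ) (hε : 0 ≤ ε)
    (h : ∀ t ∈ Icc 0 τ, HasDerivWithinAt r (r' t) (Icc 0 τ) t)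
    (h0 : ‖r 0‖ ≤ δ) (hb : ∀ t ∈ Icc 0 τ, ‖r' t‖ ≤ L * ‖r t‖ + ε) :
    ∀ t ∈ Icc 0 τ, ‖r t‖ ≤ 2 * δ + ε := by
  intro t ht
  have key := norm_le_gronwallBound_of_norm_deriv_right_le (f := r) (f' := r') (a := 0) (b := τ)
    (K := L) (δ := δ) (ε := ε) (fun t ht ↦ (h t ht).continuousWithinAt)
    (fun t ht ↦ hasDerivWithinAt_Ici_of_Icc ht (h t (Ico_subset_Icc_self ht)))
    h0 (fun t ht ↦ hb t (Ico_subset_Icc_self ht)) t ht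
  refine key.trans ?_
  have hL0 : 0 < L := by linarith
  rw [gronwallBound_of_K_ne_0 hL0.ne']
  simp only [sub_zero]
  set y := L * t with hy
  have hy0 : 0 ≤ y := mul_nonneg hL0.le ht.1
  have hy1 : y ≤ 1 / 2 := (mul_le_mul_of_nonneg_left ht.2 hL0.le).trans hτ
  -- `exp (-y) ≥ 1 - y ≥ 1/2`.
  have he : Real.exp y ≤ 2 := by
    have h1 : Real.exp y * Real.exp (-y) = 1 := by rw [← Real.exp_add]; simp
    have h2 := Real.add_one_le_exp (-y)
    have h3 := Real.exp_pos y
    nlinarith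
  have h4 : ε / L ≤ ε := div_le_self hε hL
  have h5 : 0 ≤ ε / L := div_nonneg hε hL0.le
  nlinarith [Real.add_one_le_exp y, Real.exp_pos y]

variable {E : Type*} [NormedAddCommGroup E] [NormedSpace ℝ E] [CompleteSpace E]

/-- The fundamental solution of a linear differential equation on a short time interval. -/
theorem exists_fundamental_solution {A : ℝ → E →L[ℝ] E} {τ L : ℝ} (hτ0 : 0 ≤ τ) (hL : 1 ≤ L)
    (hτ : L * τ ≤ 1 / 2) (hA : ContinuousOn A (Icc 0 τ)) (hAL : ∀ t ∈ Icc 0 τ, ‖A t‖ ≤ L) :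
    ∃ W : ℝ → E →L[ℝ] E, W 0 = ContinuousLinearMap.id ℝ E ∧
      (∀ t ∈ Icc 0 τ, HasDerivWithinAt W (A t ∘L W t) (Icc 0 τ) t) ∧
      ∀ t ∈ Icc 0 τ, ‖W t‖ ≤ 2 := by
  -- On the unit ball around the identity `‖W‖ ≤ 2`, so the speed is at most `2L`. Since `2Lτ ≤ 1`,
  -- the solution does not leave this ball before time `τ`.
  have hPL : IsPicardLindelof (fun t (W : E →L[ℝ] E) ↦ A t ∘L W) (tmin := 0) (tmax := τ)
      ⟨0, le_rfl, hτ0⟩ (ContinuousLinearMap.id ℝ E) 1 0 (2 * L).toNNReal L.toNNReal := by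
    constructor
    · intro t ht
      refine LipschitzOnWith.of_dist_le_mul fun U _ V _ ↦ ?_
      rw [dist_eq_norm, dist_eq_norm, ← ContinuousLinearMap.comp_sub,
        Real.coe_toNNReal _ (by linarith)]
      exact (ContinuousLinearMap.opNorm_comp_le _ _).trans
        (mul_le_mul_of_nonneg_right (hAL t ht) (norm_nonneg _))
    · intro W _
      exact hA.clm_comp continuousOn_const
    · intro t ht W hW
      rw [Real.coe_toNNReal _ (by linarith)]
      have h1 : ‖W‖ ≤ 2 := by
        have h2 : ‖W - ContinuousLinearMap.id ℝ E‖ ≤ 1 := by simpa [dist_eq_norm] using hW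
        have h3 := norm_le_norm_add_norm_sub' W (ContinuousLinearMap.id ℝ E)
        have h4 : ‖ContinuousLinearMap.id ℝ E‖ ≤ 1 := ContinuousLinearMap.norm_id_le
        linarith
      refine (ContinuousLinearMap.opNorm_comp_le _ _).trans ?_
      nlinarith [hAL t ht, norm_nonneg W, norm_nonneg (A t)]
    · rw [Real.coe_toNNReal _ (by linarith)]
      simp only [sub_zero, sub_self, NNReal.coe_one, NNReal.coe_zero]
      rw [max_eq_left hτ0]
      linarith
  obtain ⟨W, hW0, hW⟩ := hPL.exists_eq_forall_mem_Icc_hasDerivWithinAt₀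
  refine ⟨W, hW0, hW, fun t ht ↦ ?_⟩
  have := norm_le_of_norm_deriv_le (δ := 1) (ε := 0) hL hτ zero_le_one le_rfl hW
    (by rw [show W 0 = _ from hW0]; exact ContinuousLinearMap.norm_id_le)
    (fun t ht ↦ by
      rw [add_zero]
      exact (ContinuousLinearMap.opNorm_comp_le _ _).trans
        (mul_le_mul_of_nonneg_right (hAL t ht) (norm_nonneg _))) t ht
  linarith

/-- A family of solutions of an autonomous differential equation with a `C¹` right-hand side on a
compact convex set is `C¹` in the initial value, and its derivative solves the variational
equation. -/
theorem exists_variational_solution {s s₀ : Set E} (hs : Convex ℝ s) (hsc : IsCompact s)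
    {f : E → E} {f' : E → E →L[ℝ] E} (hf : ∀ z ∈ s, HasFDerivWithinAt f (f' z) s z)
    (hf' : ContinuousOn f' s) {τ L : ℝ} (hτ0 : 0 ≤ τ) (hL : 1 ≤ L) (hτ : L * τ ≤ 1 / 2)
    (hfL : ∀ z ∈ s, ‖f' z‖ ≤ L) {c : E → ℝ → E} (hc0 : ∀ z ∈ s₀, c z 0 = z)
    (hcs : ∀ z ∈ s₀, ∀ t ∈ Icc 0 τ, c z t ∈ s)
    (hc : ∀ z ∈ s₀, ∀ t ∈ Icc 0 τ, HasDerivWithinAt (c z) (f (c z t)) (Icc 0 τ) t) :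
    ∃ W : E → ℝ → E →L[ℝ] E, ∀ z ∈ s₀, W z 0 = ContinuousLinearMap.id ℝ E ∧
      ∀ t ∈ Icc 0 τ, HasDerivWithinAt (W z) (f' (c z t) ∘L W z t) (Icc 0 τ) t ∧
        HasFDerivWithinAt (fun z ↦ c z t) (W z t) s₀ z ∧
        ContinuousWithinAt (fun z ↦ W z t) s₀ z := by
  have hW : ∀ z, ∃ W : ℝ → E →L[ℝ] E, z ∈ s₀ → W 0 = ContinuousLinearMap.id ℝ E ∧
      (∀ t ∈ Icc 0 τ, HasDerivWithinAt W (f' (c z t) ∘L W t) (Icc 0 τ) t) ∧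
      ∀ t ∈ Icc 0 τ, ‖W t‖ ≤ 2 := by
    intro z
    by_cases hz : z ∈ s₀
    · obtain ⟨W, h⟩ := exists_fundamental_solution (A := fun t ↦ f' (c z t)) hτ0 hL hτ
        (hf'.comp (fun t ht ↦ (hc z hz t ht).continuousWithinAt) (hcs z hz))
        (fun t ht ↦ hfL _ (hcs z hz t ht))
      exact ⟨W, fun _ ↦ h⟩
    · exact ⟨0, fun h ↦ absurd h hz⟩
  choose W hW using hW
  have hlip : ∀ z ∈ s₀, ∀ z' ∈ s₀, ∀ t ∈ Icc 0 τ, ‖c z' t - c z t‖ ≤ 2 * ‖z' - z‖ := by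
    intro z hz z' hz' t ht
    have := norm_le_of_norm_deriv_le (δ := ‖z' - z‖) (ε := 0) hL hτ (norm_nonneg _) le_rfl
      (fun t ht ↦ (hc z' hz' t ht).sub (hc z hz t ht))
      (by simp [hc0 z hz, hc0 z' hz'])
      (fun t ht ↦ by
        rw [add_zero]
        exact hs.norm_image_sub_le_of_norm_hasFDerivWithin_le hf hfL (hcs z hz t ht)
          (hcs z' hz' t ht)) t ht
    simpa using this
  have huc := hsc.uniformContinuousOn_of_continuous hf'
  rw [Metric.uniformContinuousOn_iff_le] at huc
  refine ⟨W, fun z hz ↦ ⟨(hW z hz).1, fun t ht ↦ ⟨(hW z hz).2.1 t ht, ?_, ?_⟩⟩⟩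
  · rw [hasFDerivWithinAt_iff_isLittleO, Asymptotics.isLittleO_iff]
    intro ε hε
    obtain ⟨η, hη, hu⟩ := huc (ε / 2) (by positivity)
    have hnear : ∀ᶠ z' in 𝓝[s₀] z, ‖z' - z‖ ≤ η / 2 := by
      refine mem_nhdsWithin_of_mem_nhds ?_
      filter_upwards [Metric.closedBall_mem_nhds z (half_pos hη)] with z' hz'
      simpa [dist_eq_norm] using hz'
    filter_upwards [hnear, self_mem_nhdsWithin] with z' hz' hz's
    -- The first-order remainder `r` satisfies the linearised equation up to the Taylor error of `f`
    -- between the two solutions. That error is at most `(ε/2) ‖c z' t - c z t‖ ≤ ε ‖z' - z‖`, by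
    -- `hlip`, and `r` starts at zero.
    have := norm_le_of_norm_deriv_le (δ := 0) (ε := ε * ‖z' - z‖)
      (r := fun t ↦ c z' t - c z t - W z t (z' - z))
      (r' := fun t ↦ f (c z' t) - f (c z t) - f' (c z t) (W z t (z' - z)))
      hL hτ le_rfl (by positivity)
      (fun t ht ↦ by
        have h1 := ((hW z hz).2.1 t ht).clm_apply (hasDerivWithinAt_const t (Icc 0 τ) (z' - z))
        have h2 := ((hc z' hz's t ht).sub (hc z hz t ht)).sub h1
        refine h2.congr_deriv ?_
        simp)
      (by simp [hc0 z hz, hc0 z' hz's, (hW z hz).1])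
      (fun t ht ↦ by
        have hseg : segment ℝ (c z t) (c z' t) ⊆ s :=
          hs.segment_subset (hcs z hz t ht) (hcs z' hz's t ht)
        have h1 := (convex_segment (𝕜 := ℝ) (c z t)
          (c z' t)).norm_image_sub_le_of_norm_hasFDerivWithin_le'
          (f := f) (f' := f') (φ := f' (c z t)) (C := ε / 2)
          (fun p hp ↦ (hf p (hseg hp)).mono hseg)
          (fun p hp ↦ by
            rw [← dist_eq_norm]
            refine hu p (hseg hp) _ (hcs z hz t ht) ?_
            have h3 := segment_subset_closedBall_left (c z t) (c z' t) hp
            have h4 := hlip z hz z' hz's t ht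
            rw [Metric.mem_closedBall, dist_eq_norm (c z t), norm_sub_rev] at h3
            linarith)
          (left_mem_segment ℝ _ _) (right_mem_segment ℝ _ _)
        have h2 : f (c z' t) - f (c z t) - f' (c z t) (W z t (z' - z)) =
            (f (c z' t) - f (c z t) - f' (c z t) (c z' t - c z t)) +
              f' (c z t) (c z' t - c z t - W z t (z' - z)) := by
          rw [map_sub (f' (c z t)) (c z' t - c z t)]; abel
        rw [h2]
        refine (norm_add_le _ _).trans ?_
        have h3 := (f' (c z t)).le_of_opNorm_le (hfL _ (hcs z hz t ht))
          (c z' t - c z t - W z t (z' - z))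
        have h4 := mul_le_mul_of_nonneg_left (hlip z hz z' hz's t ht) (half_pos hε).le
        linarith) t ht
    simpa using this
  · rw [Metric.continuousWithinAt_iff]
    intro ε hε
    obtain ⟨η, hη, hu⟩ := huc (ε / 4) (by positivity)
    refine ⟨η / 2, by positivity, fun {z'} hz' hzz ↦ ?_⟩
    have := norm_le_of_norm_deriv_le (δ := 0) (ε := ε / 2)
      (r := fun t ↦ W z' t - W z t)
      (r' := fun t ↦ f' (c z' t) ∘L W z' t - f' (c z t) ∘L W z t)
      hL hτ le_rfl (by positivity)
      (fun t ht ↦ ((hW z' hz').2.1 t ht).sub ((hW z hz).2.1 t ht))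
      (by simp [(hW z hz).1, (hW z' hz').1])
      (fun t ht ↦ by
        have h2 : f' (c z' t) ∘L W z' t - f' (c z t) ∘L W z t =
            f' (c z' t) ∘L (W z' t - W z t) + (f' (c z' t) - f' (c z t)) ∘L W z t := by
          ext; simp
        rw [h2]
        refine (norm_add_le _ _).trans (add_le_add ?_ ?_)
        · exact (ContinuousLinearMap.opNorm_comp_le _ _).trans
            (mul_le_mul_of_nonneg_right (hfL _ (hcs z' hz' t ht)) (norm_nonneg _))
        · refine (ContinuousLinearMap.opNorm_comp_le _ _).trans ?_
          have h3 : ‖f' (c z' t) - f' (c z t)‖ ≤ ε / 4 := by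
            rw [← dist_eq_norm]
            refine hu _ (hcs z' hz' t ht) _ (hcs z hz t ht) ?_
            have h4 := hlip z hz z' hz' t ht
            rw [dist_eq_norm] at hzz ⊢
            linarith
          have h5 := (hW z hz).2.2 t ht
          nlinarith [norm_nonneg (W z t), norm_nonneg (f' (c z' t) - f' (c z t))]) t ht
    rw [dist_eq_norm]
    linarith

end ODE

/-! ### The symplectic form and the Hamiltonian field in a chart -/

section Chart

open Set Filter

variable {E : Type*} [NormedAddCommGroup E] [NormedSpace ℝ E]
  {A : Type*} [TopologicalSpace A] {I : ModelWithCorners ℝ E A}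
  {M : Type*} [TopologicalSpace M] [ChartedSpace A M]

/-- The derivative of the inverse of the chart at `x₀`. -/
def chartFrame (I : ModelWithCorners ℝ E A) {M : Type*} [TopologicalSpace M] [ChartedSpace A M]
    (x₀ : M) (z : E) : E →L[ℝ] TangentSpace I ((extChartAt I x₀).symm z) :=
  mfderivWithin 𝓘(ℝ, E) I (extChartAt I x₀).symm (range I) z

/-- A vector field read in the chart at `x₀`. -/
def chartField (X : (x : M) → TangentSpace I x) (x₀ : M) (z : E) : E :=
  mfderiv I 𝓘(ℝ, E) (extChartAt I x₀) ((extChartAt I x₀).symm z) (X ((extChartAt I x₀).symm z))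

/-- A `2`-form read in the chart at `x₀`. -/
def chartForm [IsManifold I ∞ M] (Ω : SymplecticForm I M) (x₀ : M) (z : E) : E →L[ℝ] E →L[ℝ] ℝ :=
  ContinuousLinearMap.precomp ℝ (chartFrame I x₀ z) ∘L
    Ω.form ((extChartAt I x₀).symm z) ∘L chartFrame I x₀ z

theorem chartForm_apply [IsManifold I ∞ M] (Ω : SymplecticForm I M) (x₀ : M) (z a b : E) :
    chartForm Ω x₀ z a b =
      Ω.form ((extChartAt I x₀).symm z) (chartFrame I x₀ z a) (chartFrame I x₀ z b) := rfl

section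

variable [IsManifold I ∞ M]

theorem chartFrame_chartField (X : (x : M) → TangentSpace I x) {x₀ : M} {z : E}
    (hz : z ∈ (extChartAt I x₀).target) :
    chartFrame I x₀ z (chartField X x₀ z) = X ((extChartAt I x₀).symm z) := by
  exact congrArg (fun L : TangentSpace I _ →L[ℝ] TangentSpace I _ ↦ L (X _))
    (mfderivWithin_extChartAt_symm_comp_mfderiv_extChartAt hz)

theorem mfderiv_extChartAt_chartFrame {x₀ : M} {z : E} (hz : z ∈ (extChartAt I x₀).target)
    (a : E) : mfderiv I 𝓘(ℝ, E) (extChartAt I x₀) ((extChartAt I x₀).symm z)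
      (chartFrame I x₀ z a) = a :=
  congrArg (fun L : E →L[ℝ] E ↦ L a) (mfderiv_extChartAt_comp_mfderivWithin_extChartAt_symm hz)

theorem chartFrame_mfderiv_extChartAt {x₀ x : M} (hx : x ∈ (extChartAt I x₀).source)
    (v : TangentSpace I x) : chartFrame I x₀ (extChartAt I x₀ x)
      (mfderiv I 𝓘(ℝ, E) (extChartAt I x₀) x v) = v :=
  congrArg (fun L : TangentSpace I x →L[ℝ] TangentSpace I x ↦ L v)
    (mfderivWithin_extChartAt_symm_comp_mfderiv_extChartAt' hx)

theorem contMDiffOn_chartFrame_section (x₀ : M) (a : E) :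
    ContMDiffOn I (I.prod 𝓘(ℝ, E)) ∞
      (fun x ↦ TotalSpace.mk' E (E := (TangentSpace I : M → Type _)) x
        ((trivializationAt E (TangentSpace I) x₀).symm x a))
      (trivializationAt E (TangentSpace I : M → Type _) x₀).baseSet := by
  have h := (trivializationAt E (TangentSpace I : M → Type _) x₀).contMDiffOn_symm (n := ∞) (IB := I)
  have h2 : ContMDiffOn I (I.prod 𝓘(ℝ, E)) ∞ (fun x : M ↦ (x, a))
    (trivializationAt E (TangentSpace I : M → Type _) x₀).baseSet :=
    (contMDiff_id.prodMk contMDiff_const).contMDiffOn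
  refine (h.comp h2 fun x hx ↦ ?_).congr fun x hx ↦ ?_
  · exact (trivializationAt E (TangentSpace I : M → Type _) x₀).mem_target.2 hx
  · exact Trivialization.mk_symm _ hx a

/-- In finite dimension it suffices to evaluate on constant vectors, which the inverse chart carries
to smooth local sections of the tangent bundle. -/
theorem contDiffOn_chartForm [FiniteDimensional ℝ E] (Ω : SymplecticForm I M) (x₀ : M) :
    ContDiffOn ℝ ∞ (chartForm Ω x₀) (extChartAt I x₀).target := by
  refine contDiffOn_clm_apply.2 fun a ↦ contDiffOn_clm_apply.2 fun b ↦ ?_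
  have h1 := Ω.smooth.contMDiffOn.clm_bundle_apply₂ (contMDiffOn_chartFrame_section (I := I) x₀ a)
    (contMDiffOn_chartFrame_section (I := I) x₀ b) (E₃ := fun _ : M ↦ ℝ)
  have h2 : ContMDiffOn I 𝓘(ℝ, ℝ) ∞ (fun x ↦ Ω.form x
      ((trivializationAt E (TangentSpace I) x₀).symm x a)
      ((trivializationAt E (TangentSpace I) x₀).symm x b))
      (trivializationAt E (TangentSpace I : M → Type _) x₀).baseSet := by
    intro x hx
    have := contMDiffWithinAt_totalSpace.1 (h1 x hx)
    exact this.2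
  rw [← contMDiffOn_iff_contDiffOn]
  have hmaps : ∀ z ∈ (extChartAt I x₀).target, (extChartAt I x₀).symm z ∈ (chartAt A x₀).source :=
    fun z hz ↦ by simpa only [extChartAt_source] using (extChartAt I x₀).map_target hz
  refine (h2.comp (contMDiffOn_extChartAt_symm x₀) fun z hz ↦ ?_).congr fun z hz ↦ ?_
  · rw [TangentBundle.trivializationAt_baseSet]
    exact hmaps z hz
  · have h3 : ∀ c : E, chartFrame I x₀ z c = (trivializationAt E (TangentSpace I) x₀).symm
        ((extChartAt I x₀).symm z) c := fun c ↦ by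
      have h4 := TangentBundle.symmL_trivializationAt (I := I) (hmaps z hz)
      rw [(extChartAt I x₀).right_inv hz] at h4
      have hb : (extChartAt I x₀).symm z ∈
          (trivializationAt E (TangentSpace I : M → Type _) x₀).baseSet := by
        rw [TangentBundle.trivializationAt_baseSet]
        exact hmaps z hz
      rw [← Trivialization.symmL_apply (R := ℝ) _ hb, h4]
      rfl
    rw [chartForm_apply, h3, h3]
    rfl

theorem contDiffOn_comp_extChartAt_symm {H : M → ℝ} (hH : ContMDiff I 𝓘(ℝ, ℝ) 2 H) (x₀ : M) :
    ContDiffOn ℝ 2 (H ∘ (extChartAt I x₀).symm) (extChartAt I x₀).target := by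
  rw [← contMDiffOn_iff_contDiffOn]
  have : IsManifold I 2 M := IsManifold.of_le (n := ∞)
    (WithTop.coe_le_coe.2 (le_top : (2 : ℕ∞) ≤ ⊤))
  exact hH.comp_contMDiffOn (contMDiffOn_extChartAt_symm x₀)

theorem differential_chartFrame {H : M → ℝ} (hH : ContMDiff I 𝓘(ℝ, ℝ) 2 H) {x₀ : M} {z : E}
    (hz : z ∈ (extChartAt I x₀).target) (b : E) :
    differential I H ((extChartAt I x₀).symm z) (chartFrame I x₀ z b) =
      fderivWithin ℝ (H ∘ (extChartAt I x₀).symm) (range I) z b := by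
  have h1 : HasMFDerivAt I 𝓘(ℝ, ℝ) H ((extChartAt I x₀).symm z)
      (differential I H ((extChartAt I x₀).symm z)) :=
    (hH.mdifferentiable (by norm_num) _).hasMFDerivAt
  have h2 : HasMFDerivWithinAt 𝓘(ℝ, E) I (extChartAt I x₀).symm (range I) z (chartFrame I x₀ z) :=
    (mdifferentiableWithinAt_extChartAt_symm hz).hasMFDerivWithinAt
  have h3 : HasFDerivWithinAt (H ∘ (extChartAt I x₀).symm)
      (show E →L[ℝ] ℝ from differential I H ((extChartAt I x₀).symm z) ∘L chartFrame I x₀ z)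
      (range I) z := (HasMFDerivAt.comp_hasMFDerivWithinAt z h1 h2).hasFDerivWithinAt
  have hu : UniqueDiffWithinAt ℝ (range I) z :=
    I.uniqueDiffOn _ (extChartAt_target_subset_range x₀ hz)
  rw [h3.fderivWithin hu]
  rfl

theorem chartForm_chartField (Ω : SymplecticForm I M) {H : M → ℝ}
    (hH : ContMDiff I 𝓘(ℝ, ℝ) 2 H) {X : (x : M) → TangentSpace I x}
    (hX : ∀ x v, Ω.form x (X x) v = differential I H x v) {x₀ : M} {z : E}
    (hz : z ∈ (extChartAt I x₀).target) :
    chartForm Ω x₀ z (chartField X x₀ z) =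
      fderivWithin ℝ (H ∘ (extChartAt I x₀).symm) (range I) z := by
  ext b
  rw [chartForm_apply, chartFrame_chartField X hz, hX, differential_chartFrame hH hz]

theorem chartForm_isInvertible [FiniteDimensional ℝ E] (Ω : SymplecticForm I M) {x₀ : M} {z : E}
    (hz : z ∈ (extChartAt I x₀).target) : (chartForm Ω x₀ z).IsInvertible := by
  have : CompleteSpace E := FiniteDimensional.complete ℝ E
  let P : TangentSpace I ((extChartAt I x₀).symm z) →L[ℝ] E :=
    mfderiv I 𝓘(ℝ, E) (extChartAt I x₀) ((extChartAt I x₀).symm z)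
  have hDP : ∀ v, chartFrame I x₀ z (P v) = v := fun v ↦
    congrArg (fun L : TangentSpace I _ →L[ℝ] TangentSpace I _ ↦ L v)
      (mfderivWithin_extChartAt_symm_comp_mfderiv_extChartAt hz)
  have hPD : ∀ a, P (chartFrame I x₀ z a) = a := mfderiv_extChartAt_chartFrame hz
  have hinj : (chartForm Ω x₀ z).ker = ⊥ := by
    refine (LinearMap.ker_eq_bot').2 fun a ha ↦ ?_
    have h1 : chartFrame I x₀ z a = 0 := Ω.nondegenerate _ _ fun v ↦ by
      rw [← hDP v, ← chartForm_apply]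
      exact congrArg (fun L : E →L[ℝ] ℝ ↦ L (P v)) ha
    rw [← hPD a, h1, map_zero]
  have hsurj : (chartForm Ω x₀ z).range = ⊤ := by
    refine LinearMap.range_eq_top.2 fun l ↦ ?_
    obtain ⟨u, hu⟩ := Ω.exists_form_eq ((extChartAt I x₀).symm z) (l ∘L P)
    refine ⟨P u, ?_⟩
    ext b
    change chartForm Ω x₀ z (P u) b = l b
    rw [chartForm_apply, hDP, hu]
    change l (P _) = _
    rw [hPD]
  exact ⟨ContinuousLinearEquiv.ofBijective (chartForm Ω x₀ z) hinj hsurj, rfl⟩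

/-- In the chart `X = Ω⁻¹ dH`: inversion of operators is smooth and `dH` is `C¹`. Derivatives within
the chart target give regularity up to the boundary. -/
theorem contDiffOn_chartField [FiniteDimensional ℝ E] (Ω : SymplecticForm I M) {H : M → ℝ}
    (hH : ContMDiff I 𝓘(ℝ, ℝ) 2 H) {X : (x : M) → TangentSpace I x}
    (hX : ∀ x v, Ω.form x (X x) v = differential I H x v) (x₀ : M) :
    ContDiffOn ℝ 1 (chartField X x₀) (extChartAt I x₀).target := by
  have : CompleteSpace E := FiniteDimensional.complete ℝ E
  have h1 : ContDiffOn ℝ 1 (fun z ↦ (chartForm Ω x₀ z).inverse) (extChartAt I x₀).target :=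
    fun z hz ↦ ((chartForm_isInvertible Ω hz).contDiffAt_map_inverse).comp_contDiffWithinAt z
      ((contDiffOn_chartForm Ω x₀ z hz).of_le (by simp))
  have h2 : ContDiffOn ℝ 1 (fderivWithin ℝ (H ∘ (extChartAt I x₀).symm) (extChartAt I x₀).target)
      (extChartAt I x₀).target :=
    (contDiffOn_comp_extChartAt_symm hH x₀).fderivWithin (uniqueDiffOn_extChartAt_target x₀)
      (by norm_num)
  refine (h1.clm_apply h2).congr fun z hz ↦ ?_
  have h3 : fderivWithin ℝ (H ∘ (extChartAt I x₀).symm) (extChartAt I x₀).target z =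
      fderivWithin ℝ (H ∘ (extChartAt I x₀).symm) (range I) z := by
    refine fderivWithin_subset (extChartAt_target_subset_range x₀)
      (uniqueDiffOn_extChartAt_target x₀ z hz) ?_
    exact ((contDiffOn_comp_extChartAt_symm hH x₀ z hz).differentiableWithinAt
      (by norm_num)).mono_of_mem_nhdsWithin (extChartAt_target_mem_nhdsWithin_of_mem hz)
  rw [h3, ← chartForm_chartField Ω hH hX hz]
  obtain ⟨e, he⟩ := chartForm_isInvertible Ω hz
  rw [← he]
  simp

theorem chartForm_antisymm (Ω : SymplecticForm I M) (x₀ : M) (z a b : E) :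
    chartForm Ω x₀ z a b = -chartForm Ω x₀ z b a := by
  have h : ∀ c, chartForm Ω x₀ z c c = 0 := fun c ↦ Ω.alternating _ _
  have h1 := h (a + b)
  simp only [map_add, add_apply, h] at h1
  linarith

/-- The Lie derivative of the symplectic form along a Hamiltonian vector field vanishes. -/
theorem lieDerivative_chartForm [FiniteDimensional ℝ E] (Ω : SymplecticForm I M) {H : M → ℝ}
    (hH : ContMDiff I 𝓘(ℝ, ℝ) 2 H) {X : (x : M) → TangentSpace I x}
    (hX : ∀ x v, Ω.form x (X x) v = differential I H x v) {x₀ : M} {z : E}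
    (hz : z ∈ (extChartAt I x₀).target) (a b : E) :
    fderivWithin ℝ (chartForm Ω x₀) (range I) z (chartField X x₀ z) a b +
      chartForm Ω x₀ z (fderivWithin ℝ (chartField X x₀) (range I) z a) b +
      chartForm Ω x₀ z a (fderivWithin ℝ (chartField X x₀) (range I) z b) = 0 := by
  have hr := extChartAt_target_subset_range x₀ hz
  have hu : UniqueDiffWithinAt ℝ (range I) z := I.uniqueDiffOn _ hr
  have hn := extChartAt_target_mem_nhdsWithin_of_mem hz
  have hω₀ : DifferentiableWithinAt ℝ (chartForm Ω x₀) (range I) z :=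
    ((contDiffOn_chartForm Ω x₀ z hz).differentiableWithinAt
      (by norm_num)).mono_of_mem_nhdsWithin hn
  have hω := hω₀.hasFDerivWithinAt
  have hf : HasFDerivWithinAt (chartField X x₀) (fderivWithin ℝ (chartField X x₀) (range I) z)
      (range I) z :=
    (((contDiffOn_chartField Ω hH hX x₀ z hz).differentiableWithinAt
      (by norm_num)).mono_of_mem_nhdsWithin hn).hasFDerivWithinAt
  set ω' := fderivWithin ℝ (chartForm Ω x₀) (range I) z
  set f' := fderivWithin ℝ (chartField X x₀) (range I) z
  set h := H ∘ (extChartAt I x₀).symm with hh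
  have hcoeff : ∀ a b c : E, fderivWithin ℝ (fun z ↦ chartForm Ω x₀ z a b) (range I) z c
      = ω' c a b := by
    intro a b c
    have h1 := (hω.clm_apply (hasFDerivWithinAt_const a z (range I))).clm_apply
      (hasFDerivWithinAt_const b z (range I))
    rw [h1.fderivWithin hu]
    simp
  have hanti : ∀ a b c : E, ω' c a b = -ω' c b a := by
    intro a b c
    rw [← hcoeff, ← hcoeff]
    have : (fun z ↦ chartForm Ω x₀ z a b) = fun z ↦ -chartForm Ω x₀ z b a := by
      funext z; exact chartForm_antisymm Ω x₀ z a b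
    rw [this, fderivWithin_fun_neg hu]
    rfl
  have hclosed := Ω.closed x₀ z hz (chartField X x₀ z) a b
  have hcl : ω' (chartField X x₀ z) a b + ω' a b (chartField X x₀ z) +
      ω' b (chartField X x₀ z) a = 0 := by
    rw [← hcoeff, ← hcoeff, ← hcoeff]
    exact hclosed
  -- This is the derivative of the identity `Ω(X, ·) = dH`. Its symmetry in `c` and `b`, combined
  -- with closedness, is the claim.
  have hprod : ∀ c b : E, fderivWithin ℝ (fderivWithin ℝ h (range I)) (range I) z c b =
      ω' c (chartField X x₀ z) b + chartForm Ω x₀ z (f' c) b := by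
    intro c b
    have h1 : HasFDerivWithinAt (fderivWithin ℝ h (range I)) _ (range I) z :=
      (hω.clm_apply hf).congr_of_eventuallyEq
        (by filter_upwards [hn] with y hy using (chartForm_chartField Ω hH hX hy).symm)
        (chartForm_chartField Ω hH hX hz).symm
    rw [h1.fderivWithin hu]
    simp [add_comm]
  -- Second derivatives are symmetric at boundary points as well, because the range of the model
  -- lies in the closure of its interior.
  have hsymm : IsSymmSndFDerivWithinAt ℝ h (range I) z := by
    refine ContDiffWithinAt.isSymmSndFDerivWithinAt (n := 2)
      ((contDiffOn_comp_extChartAt_symm hH x₀ z hz).mono_of_mem_nhdsWithin hn) (by simp)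
      I.uniqueDiffOn (I.range_subset_closure_interior hr) hr
  have h1 := hsymm a b
  rw [hprod, hprod] at h1
  rw [chartForm_antisymm Ω x₀ z a]
  rw [hanti b (chartField X x₀ z) a] at hcl
  linarith

end

end Chart

/-! ### Local theory of the flow: uniqueness, differentiability, invariance of the form -/

section Flow

set_option linter.unusedSectionVars false

open Set Filter

variable {E : Type*} [NormedAddCommGroup E] [NormedSpace ℝ E]
  {A : Type*} [TopologicalSpace A] {I : ModelWithCorners ℝ E A}
  {M : Type*} [TopologicalSpace M] [ChartedSpace A M] [IsManifold I ∞ M]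

/-- The derivative of the chart at `x₀`, as a map into the model space. -/
def chartDeriv (I : ModelWithCorners ℝ E A) {M : Type*} [TopologicalSpace M] [ChartedSpace A M]
    (x₀ x : M) : TangentSpace I x →L[ℝ] E :=
  mfderiv I 𝓘(ℝ, E) (extChartAt I x₀) x

theorem hasMFDerivAt_chartDeriv {x₀ x : M} (hx : x ∈ (extChartAt I x₀).source) :
    HasMFDerivAt I 𝓘(ℝ, E) (extChartAt I x₀) x (chartDeriv I x₀ x) :=
  (mdifferentiableAt_extChartAt (by simpa only [extChartAt_source] using hx)).hasMFDerivAt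

theorem chartFrame_chartDeriv {x₀ x : M} (hx : x ∈ (extChartAt I x₀).source)
    (v : TangentSpace I x) : chartFrame I x₀ (extChartAt I x₀ x) (chartDeriv I x₀ x v) = v :=
  chartFrame_mfderiv_extChartAt hx v

theorem hasDerivAt_extChartAt_comp {X : (x : M) → TangentSpace I x} {γ : ℝ → M} {t : ℝ} {x₀ : M}
    (hγ : HasMFDerivAt 𝓘(ℝ, ℝ) I γ t ((1 : ℝ →L[ℝ] ℝ).smulRight (X (γ t))))
    (ht : γ t ∈ (extChartAt I x₀).source) :
    HasDerivAt (fun t ↦ extChartAt I x₀ (γ t)) (chartField X x₀ (extChartAt I x₀ (γ t))) t := by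
  have h2 : HasFDerivAt (fun t ↦ extChartAt I x₀ (γ t))
      (show ℝ →L[ℝ] E from chartDeriv I x₀ (γ t) ∘L (1 : ℝ →L[ℝ] ℝ).smulRight (X (γ t))) t :=
    ((hasMFDerivAt_chartDeriv ht).comp t hγ).hasFDerivAt
  have h3 : chartField X x₀ (extChartAt I x₀ (γ t)) = chartDeriv I x₀ (γ t) (X (γ t)) := by
    unfold chartField
    rw [(extChartAt I x₀).left_inv ht]
    rfl
  rw [h3]
  refine h2.hasDerivAt.congr_deriv ?_
  change chartDeriv I x₀ (γ t) ((1 : ℝ) • X (γ t)) = _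
  rw [one_smul]

/-- The intersection of the range of the model with a closed ball around the image of `x₀`. -/
def halfBall (I : ModelWithCorners ℝ E A) {M : Type*} [TopologicalSpace M] [ChartedSpace A M]
    (x₀ : M) (r : ℝ) : Set E :=
  Metric.closedBall (extChartAt I x₀ x₀) r ∩ range I

theorem convex_halfBall (x₀ : M) (r : ℝ) : Convex ℝ (halfBall I x₀ r) :=
  (convex_closedBall _ _).inter I.convex_range

theorem isCompact_halfBall [FiniteDimensional ℝ E] (x₀ : M) (r : ℝ) :
    IsCompact (halfBall I x₀ r) := by
  have : ProperSpace E := FiniteDimensional.proper ℝ E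
  exact (isCompact_closedBall _ _).inter_right I.isClosed_range

/-- A small half ball in a chart, on which the vector field and its derivative are bounded. -/
theorem exists_halfBall [FiniteDimensional ℝ E] {X : (x : M) → TangentSpace I x} {x₀ : M}
    (hX : ContDiffOn ℝ 1 (chartField X x₀) (extChartAt I x₀).target) :
    ∃ r > 0, halfBall I x₀ r ⊆ (extChartAt I x₀).target ∧ ∃ L ≥ 1, ∃ f' : E → E →L[ℝ] E,
      (∀ z ∈ halfBall I x₀ r, f' z = fderivWithin ℝ (chartField X x₀) (range I) z) ∧
      (∀ z ∈ halfBall I x₀ r, HasFDerivWithinAt (chartField X x₀) (f' z) (halfBall I x₀ r) z) ∧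
      ContinuousOn f' (halfBall I x₀ r) ∧ (∀ z ∈ halfBall I x₀ r, ‖f' z‖ ≤ L) ∧
      ∀ z ∈ halfBall I x₀ r, ‖chartField X x₀ z‖ ≤ L := by
  obtain ⟨r, hr, hrs⟩ := Metric.mem_nhdsWithin_iff.1 (extChartAt_target_mem_nhdsWithin (I := I) x₀)
  have hsub : halfBall I x₀ (r / 2) ⊆ (extChartAt I x₀).target :=
    fun z hz ↦ hrs ⟨Metric.closedBall_subset_ball (by linarith) hz.1, hz.2⟩
  have hu := uniqueDiffOn_extChartAt_target (I := I) (𝕜 := ℝ) x₀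
  have hcont : ContinuousOn (fderivWithin ℝ (chartField X x₀) (extChartAt I x₀).target)
      (halfBall I x₀ (r / 2)) :=
    (hX.continuousOn_fderivWithin hu le_rfl).mono hsub
  obtain ⟨L₁, hL₁⟩ := (isCompact_halfBall (I := I) x₀ (r / 2)).exists_bound_of_continuousOn hcont
  obtain ⟨L₂, hL₂⟩ := (isCompact_halfBall (I := I) x₀ (r / 2)).exists_bound_of_continuousOn
    (hX.continuousOn.mono hsub)
  refine ⟨r / 2, by positivity, hsub, max 1 (max L₁ L₂), le_max_left _ _,
    fderivWithin ℝ (chartField X x₀) (extChartAt I x₀).target, fun z hz ↦ ?_, fun z hz ↦ ?_, hcont,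
    fun z hz ↦ (hL₁ z hz).trans ((le_max_left _ _).trans (le_max_right _ _)),
    fun z hz ↦ (hL₂ z hz).trans ((le_max_right _ _).trans (le_max_right _ _))⟩
  · refine fderivWithin_subset (extChartAt_target_subset_range x₀) (hu z (hsub hz)) ?_
    exact ((hX z (hsub hz)).differentiableWithinAt one_ne_zero).mono_of_mem_nhdsWithin
      (extChartAt_target_mem_nhdsWithin_of_mem (hsub hz))
  · exact ((hX z (hsub hz)).differentiableWithinAt one_ne_zero).hasFDerivWithinAt.mono hsub

/-- Integral curves of a `C¹` vector field are unique, also at the boundary. -/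
theorem isMIntegralCurve_unique [FiniteDimensional ℝ E] [T2Space M]
    {X : (x : M) → TangentSpace I x}
    (hX : ∀ x₀, ContDiffOn ℝ 1 (chartField X x₀) (extChartAt I x₀).target) {γ γ' : ℝ → M}
    (hγ : IsMIntegralCurve γ X) (hγ' : IsMIntegralCurve γ' X) {t₀ : ℝ} (h0 : γ t₀ = γ' t₀) :
    γ = γ' := by
  have hc : Continuous γ := continuous_iff_continuousAt.2 fun t ↦ (hγ t).continuousAt
  have hc' : Continuous γ' := continuous_iff_continuousAt.2 fun t ↦ (hγ' t).continuousAt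
  have hclosed : IsClosed {t | γ t = γ' t} := isClosed_eq hc hc'
  have hopen : IsOpen {t | γ t = γ' t} := by
    rw [isOpen_iff_mem_nhds]
    intro t ht
    have ht : γ t = γ' t := ht
    set x₀ := γ t with hx₀
    obtain ⟨r, hr, hrs, L, hL, f', -, hf', -, hfL, -⟩ := exists_halfBall (hX x₀)
    have hnear : ∀ g : ℝ → M, IsMIntegralCurve g X → Continuous g → g t = x₀ → ∀ᶠ u in 𝓝 t,
        g u ∈ (extChartAt I x₀).source ∧ HasDerivAt (fun t ↦ extChartAt I x₀ (g t))
          (chartField X x₀ (extChartAt I x₀ (g u))) u ∧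
          extChartAt I x₀ (g u) ∈ halfBall I x₀ r := by
      intro g hg hgc hgt
      have h1 : ∀ᶠ u in 𝓝 t, g u ∈ (extChartAt I x₀).source :=
        hgc.continuousAt.preimage_mem_nhds (by rw [hgt]; exact extChartAt_source_mem_nhds x₀)
      have h2 : ∀ᶠ u in 𝓝 t, extChartAt I x₀ (g u) ∈
          Metric.closedBall (extChartAt I x₀ x₀) r := by
        have : ContinuousAt (fun u ↦ extChartAt I x₀ (g u)) t :=
          ContinuousAt.comp (by rw [hgt]; exact continuousAt_extChartAt x₀) hgc.continuousAt
        refine this.preimage_mem_nhds ?_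
        rw [hgt]
        exact Metric.closedBall_mem_nhds _ hr
      filter_upwards [h1, h2] with u hu1 hu2
      exact ⟨hu1, hasDerivAt_extChartAt_comp (hg u) hu1, hu2,
        extChartAt_target_subset_range x₀ ((extChartAt I x₀).map_source hu1)⟩
    have hn := hnear γ hγ hc hx₀.symm
    have hn' := hnear γ' hγ' hc' ht.symm
    -- Half balls are convex, so the derivative bound gives a Lipschitz bound even when `x₀` lies on
    -- the boundary.
    have hlip : LipschitzOnWith L.toNNReal (chartField X x₀) (halfBall I x₀ r) :=
      (convex_halfBall x₀ r).lipschitzOnWith_of_nnnorm_hasFDerivWithin_le hf' fun z hz ↦ by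
        rw [← NNReal.coe_le_coe, Real.coe_toNNReal _ (by linarith)]
        exact hfL z hz
    have heq := ODE_solution_unique_of_eventually (v := fun _ ↦ chartField X x₀)
      (s := fun _ ↦ halfBall I x₀ r) (t₀ := t) (Eventually.of_forall fun _ ↦ hlip)
      (hn.mono fun u hu ↦ hu.2) (hn'.mono fun u hu ↦ hu.2) (by rw [← ht])
    filter_upwards [heq, hn, hn'] with u hu hu1 hu2
    exact (extChartAt I x₀).injOn hu1.1 hu2.1 hu
  have huniv := IsClopen.eq_univ ⟨hclosed, hopen⟩ ⟨t₀, h0⟩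
  funext t
  exact (huniv ▸ mem_univ t : t ∈ {t | γ t = γ' t})

/-- For a short time, integral curves starting close to `x₀` stay in a half ball around `x₀`. -/
theorem mem_halfBall_of_isMIntegralCurve [FiniteDimensional ℝ E] [T2Space M]
    {X : (x : M) → TangentSpace I x} {x₀ : M} {r L τ : ℝ} (hr : 0 < r)
    (hrs : halfBall I x₀ r ⊆ (extChartAt I x₀).target) (hL : 1 ≤ L)
    (hXL : ∀ z ∈ halfBall I x₀ r, ‖chartField X x₀ z‖ ≤ L) (hτ : L * τ ≤ r / 4)
    {γ : ℝ → M} (hγ : IsMIntegralCurve γ X) (h0 : γ 0 ∈ (extChartAt I x₀).source)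
    (h0' : extChartAt I x₀ (γ 0) ∈ Metric.ball (extChartAt I x₀ x₀) (r / 2)) :
    ∀ t ∈ Icc 0 τ, γ t ∈ (extChartAt I x₀).source ∧ extChartAt I x₀ (γ t) ∈ halfBall I x₀ r := by
  set p := extChartAt I x₀ x₀ with hp
  have hc : Continuous γ := continuous_iff_continuousAt.2 fun t ↦ (hγ t).continuousAt
  set V : Set M := (extChartAt I x₀).source ∩ extChartAt I x₀ ⁻¹' Metric.ball p r with hV
  have hVo : IsOpen V :=
    (continuousOn_extChartAt x₀).isOpen_inter_preimage (isOpen_extChartAt_source x₀)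
      Metric.isOpen_ball
  have hVhalf : ∀ x ∈ V, extChartAt I x₀ x ∈ halfBall I x₀ r := fun x hx ↦
    ⟨Metric.ball_subset_closedBall hx.2,
      extChartAt_target_subset_range x₀ ((extChartAt I x₀).map_source hx.1)⟩
  have hbad : ∀ t ∈ Icc 0 τ, γ t ∈ V := by
    by_contra hcon
    push Not at hcon
    have hcl : IsCompact (Icc 0 τ ∩ γ ⁻¹' Vᶜ) :=
      isCompact_Icc.inter_right (hVo.isClosed_compl.preimage hc)
    obtain ⟨t, ht, htV⟩ := hcon
    -- `t₁` is the first exit time from `V`. Before it the curve moves by at most `Lτ ≤ r/4` from a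
    -- point at distance less than `r/2`, so it stays in the compact set `C ⊆ V` of radius `3r/4`.
    -- Then so does its limit at `t₁`.
    obtain ⟨t₁, ⟨ht₁, ht₁V⟩, hmin⟩ := hcl.exists_isLeast ⟨t, ht, htV⟩
    have h0V : γ 0 ∈ V := ⟨h0, Metric.ball_subset_ball (by linarith) h0'⟩
    have ht₁0 : 0 < t₁ := lt_of_le_of_ne ht₁.1 fun h ↦ ht₁V (h ▸ h0V)
    have hlt : ∀ u ∈ Ico 0 t₁, γ u ∈ V := fun u hu ↦ by
      by_contra hcon
      exact absurd (hmin ⟨⟨hu.1, hu.2.le.trans ht₁.2⟩, hcon⟩) (not_le.2 hu.2)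
    set C : Set M := (extChartAt I x₀).symm '' halfBall I x₀ (3 * r / 4) with hC
    have hsub : halfBall I x₀ (3 * r / 4) ⊆ halfBall I x₀ r :=
      fun z hz ↦ ⟨Metric.closedBall_subset_closedBall (by linarith) hz.1, hz.2⟩
    have hCc : IsClosed C :=
      ((isCompact_halfBall x₀ _).image_of_continuousOn
        ((continuousOn_extChartAt_symm x₀).mono (hsub.trans hrs))).isClosed
    have hCV : C ⊆ V := by
      rintro _ ⟨z, hz, rfl⟩
      refine ⟨(extChartAt I x₀).map_target (hrs (hsub hz)), ?_⟩
      rw [mem_preimage, (extChartAt I x₀).right_inv (hrs (hsub hz))]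
      exact Metric.closedBall_subset_ball (by linarith) hz.1
    have hC₁ : ∀ u ∈ Ico 0 t₁, γ u ∈ C := by
      intro u hu
      have hIcc : ∀ w ∈ Icc 0 u, γ w ∈ V := fun w hw ↦ hlt w ⟨hw.1, hw.2.trans_lt hu.2⟩
      have hmv := norm_image_sub_le_of_norm_deriv_le_segment' (a := 0) (b := u)
        (f := fun t ↦ extChartAt I x₀ (γ t))
        (fun w hw ↦ (hasDerivAt_extChartAt_comp (hγ w) (hIcc w hw).1).hasDerivWithinAt)
        (C := L) (fun w hw ↦ hXL _ (hVhalf _ (hIcc w (Ico_subset_Icc_self hw)))) u ⟨hu.1, le_rfl⟩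
      refine ⟨extChartAt I x₀ (γ u), ⟨?_, (hVhalf _ (hlt u hu)).2⟩,
        (extChartAt I x₀).left_inv (hlt u hu).1⟩
      rw [Metric.mem_closedBall]
      rw [Metric.mem_ball] at h0'
      have h1 := dist_triangle (extChartAt I x₀ (γ u)) (extChartAt I x₀ (γ 0)) p
      rw [← dist_eq_norm] at hmv
      have h2 : L * (u - 0) ≤ L * τ :=
        mul_le_mul_of_nonneg_left (by linarith [hu.2, ht₁.2]) (by linarith)
      linarith
    have hmem : t₁ ∈ closure (Ico 0 t₁) := by
      rw [closure_Ico ht₁0.ne]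
      exact ⟨ht₁0.le, le_rfl⟩
    have h3 : γ t₁ ∈ closure C := map_mem_closure hc hmem hC₁
    rw [hCc.closure_eq] at h3
    exact ht₁V (hCV h3)
  exact fun t ht ↦ ⟨(hbad t ht).1, hVhalf _ (hbad t ht)⟩

/-- All tangent spaces are definitionally the model space, so `a` and `b` can be kept fixed while
the base point is rewritten. -/
theorem form_congr_point (Ω : SymplecticForm I M) {x y : M} (h : x = y) (a b : E) :
    Ω.form x a b = Ω.form y a b := by
  subst h; rfl

theorem form_eq_chartForm (Ω : SymplecticForm I M) {x₀ x : M} (hx : x ∈ (extChartAt I x₀).source)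
    (v w : TangentSpace I x) : Ω.form x v w =
      chartForm Ω x₀ (extChartAt I x₀ x) (chartDeriv I x₀ x v) (chartDeriv I x₀ x w) := by
  rw [chartForm_apply, chartFrame_chartDeriv hx, chartFrame_chartDeriv hx]
  exact form_congr_point Ω ((extChartAt I x₀).left_inv hx).symm v w

set_option synthInstance.maxHeartbeats 200000 in
/-- The chart expression of the symplectic form is constant along the linearised flow. -/
theorem hasDerivWithinAt_chartForm_apply [FiniteDimensional ℝ E] (Ω : SymplecticForm I M)
    {H : M → ℝ} (hH : ContMDiff I 𝓘(ℝ, ℝ) 2 H) {X : (x : M) → TangentSpace I x}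
    (hX : ∀ x v, Ω.form x (X x) v = differential I H x v) {x₀ : M} {c u w : ℝ → E} {s : Set ℝ}
    {t : ℝ} (hz : c t ∈ (extChartAt I x₀).target)
    (hc : HasDerivWithinAt c (chartField X x₀ (c t)) s t) (hcs : MapsTo c s (range I))
    (hu : HasDerivWithinAt u (fderivWithin ℝ (chartField X x₀) (range I) (c t) (u t)) s t)
    (hw : HasDerivWithinAt w (fderivWithin ℝ (chartField X x₀) (range I) (c t) (w t)) s t) :
    HasDerivWithinAt (fun t ↦ chartForm Ω x₀ (c t) (u t) (w t)) 0 s t := by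
  have hd : DifferentiableWithinAt ℝ (chartForm Ω x₀) (range I) (c t) :=
    ((contDiffOn_chartForm Ω x₀ _ hz).differentiableWithinAt
      (by norm_num)).mono_of_mem_nhdsWithin (extChartAt_target_mem_nhdsWithin_of_mem hz)
  have h3 : HasDerivWithinAt (fun t ↦ chartForm Ω x₀ (c t))
      (fderivWithin ℝ (chartForm Ω x₀) (range I) (c t) (chartField X x₀ (c t))) s t :=
    HasFDerivWithinAt.comp_hasDerivWithinAt (E := E →L[ℝ] E →L[ℝ] ℝ) t hd.hasFDerivWithinAt hc hcs
  refine ((h3.clm_apply hu).clm_apply hw).congr_deriv ?_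
  exact lieDerivative_chartForm Ω hH hX hz (u t) (w t)

/-- `f` is of class `C¹` and preserves the symplectic form at `x`. -/
def IsSymplecticAt (Ω : SymplecticForm I M) (f : M → M) (x : M) : Prop :=
  ContMDiffAt I I 1 f x ∧ ∀ v w : TangentSpace I x,
    Ω.form (f x) (mfderiv I I f x v) (mfderiv I I f x w) = Ω.form x v w

/-- Locally and for short times, a Hamiltonian flow consists of symplectic `C¹` maps. -/
theorem exists_isSymplecticAt_nhds [FiniteDimensional ℝ E] [T2Space M] (Ω : SymplecticForm I M)
    {H : M → ℝ} (hH : ContMDiff I 𝓘(ℝ, ℝ) 2 H) {X : (x : M) → TangentSpace I x}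
    (hX : ∀ x v, Ω.form x (X x) v = differential I H x v) {φ : ℝ → M → M} (hφ : IsFlowOf X φ)
    (x₀ : M) : ∃ τ > 0, ∃ U ∈ 𝓝 x₀, ∀ t ∈ Icc 0 τ, ∀ x ∈ U, IsSymplecticAt Ω (φ t) x := by
  have : CompleteSpace E := FiniteDimensional.complete ℝ E
  obtain ⟨r, hr, hrs, L, hL, f', hf'', hf', hf'c, hfL, hXL⟩ :=
    exists_halfBall (contDiffOn_chartField Ω hH hX x₀)
  set e := extChartAt I x₀ with he
  set p := e x₀ with hp
  set s₀ : Set E := range I ∩ Metric.ball p (r / 2) with hs₀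
  have hs₀t : s₀ ⊆ e.target := fun z hz ↦
    hrs ⟨Metric.ball_subset_closedBall (Metric.ball_subset_ball (by linarith) hz.2), hz.1⟩
  set U : Set M := e.source ∩ e ⁻¹' Metric.ball p (r / 2) with hU
  have hUo : IsOpen U :=
    (continuousOn_extChartAt x₀).isOpen_inter_preimage (isOpen_extChartAt_source x₀)
      Metric.isOpen_ball
  -- The first bound keeps orbits from `U` inside the half ball; the second is the smallness needed
  -- for the variational equation.
  set τ : ℝ := min (r / (4 * L)) (1 / (2 * L)) with hτ
  have hL0 : 0 < L := by linarith
  have hτ0 : 0 < τ := by positivity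
  have hτ1 : L * τ ≤ r / 4 := by
    calc L * τ ≤ L * (r / (4 * L)) := mul_le_mul_of_nonneg_left (min_le_left _ _) hL0.le
      _ = r / 4 := by field_simp
  have hτ2 : L * τ ≤ 1 / 2 := by
    calc L * τ ≤ L * (1 / (2 * L)) := mul_le_mul_of_nonneg_left (min_le_right _ _) hL0.le
      _ = 1 / 2 := by field_simp
  have hsU : ∀ z ∈ s₀, e.symm z ∈ U := fun z hz ↦
    ⟨e.map_target (hs₀t hz), by rw [mem_preimage, e.right_inv (hs₀t hz)]; exact hz.2⟩
  have hUs : ∀ x ∈ U, e x ∈ s₀ := fun x hx ↦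
    ⟨extChartAt_target_subset_range x₀ (e.map_source hx.1), hx.2⟩
  have hstay : ∀ x ∈ U, ∀ t ∈ Icc 0 τ, φ t x ∈ e.source ∧ e (φ t x) ∈ halfBall I x₀ r := by
    intro x hx
    refine mem_halfBall_of_isMIntegralCurve (γ := fun t ↦ φ t x) hr hrs hL hXL hτ1 (hφ x).2 ?_ ?_
    · simp only [(hφ x).1]; exact hx.1
    · simp only [(hφ x).1]; exact hx.2
  obtain ⟨W, hW⟩ := exists_variational_solution (s := halfBall I x₀ r) (s₀ := s₀)
    (convex_halfBall x₀ r) (isCompact_halfBall x₀ r) hf' hf'c hτ0.le hL hτ2 hfL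
    (c := fun z t ↦ e (φ t (e.symm z)))
    (fun z hz ↦ by simp only [(hφ _).1]; exact e.right_inv (hs₀t hz))
    (fun z hz t ht ↦ (hstay _ (hsU z hz) t ht).2)
    (fun z hz t ht ↦ (hasDerivAt_extChartAt_comp ((hφ (e.symm z)).2 t)
      (hstay _ (hsU z hz) t ht).1).hasDerivWithinAt)
  have hs₀n : ∀ z ∈ s₀, s₀ ∈ 𝓝[range I] z := fun z hz ↦
    inter_mem_nhdsWithin _ (Metric.isOpen_ball.mem_nhds hz.2)
  refine ⟨τ, hτ0, U, hUo.mem_nhds ⟨mem_extChartAt_source x₀, Metric.mem_ball_self (by positivity)⟩,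
    fun t ht x hx ↦ ?_⟩
  have hz := hUs x hx
  have hst := hstay x hx t ht
  have hcontAt : ContinuousAt (φ t) x := by
    have h1 : ContinuousWithinAt (fun z ↦ e (φ t (e.symm z))) s₀ (e x) :=
      ((hW _ hz).2 t ht).2.1.continuousWithinAt
    have h2 : ContinuousWithinAt (fun y ↦ e (φ t (e.symm (e y)))) U x :=
      h1.comp (continuousAt_extChartAt' hx.1).continuousWithinAt hUs
    have h3 : ContinuousWithinAt (fun y ↦ e.symm (e (φ t (e.symm (e y))))) U x := by
      refine ContinuousAt.comp_continuousWithinAt (g := e.symm) ?_ h2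
      rw [e.left_inv hx.1]
      exact continuousAt_extChartAt_symm' hst.1
    refine (h3.continuousAt (hUo.mem_nhds hx)).congr ?_
    filter_upwards [hUo.mem_nhds hx] with y hy
    rw [e.left_inv hy.1, e.left_inv (hstay y hy t ht).1]
  have hC1 : ContMDiffAt I I 1 (φ t) x := by
    rw [contMDiffAt_iff_of_mem_source (x := x₀) (y := x₀) (by simpa [he] using hx.1)
      (by simpa [he] using hst.1)]
    refine ⟨hcontAt, ?_⟩
    -- The solution `W` of the variational equation is a continuous derivative of the time-`t` map
    -- in the chart.
    have h1 : ContDiffWithinAt ℝ (0 + 1) (fun z ↦ e (φ t (e.symm z))) s₀ (e x) := by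
      rw [contDiffWithinAt_succ_iff_hasFDerivWithinAt (by simp)]
      refine ⟨s₀, ?_, by simp, fun z ↦ W z t, fun z hz ↦ ((hW z hz).2 t ht).2.1, ?_⟩
      · rw [insert_eq_of_mem hz]; exact self_mem_nhdsWithin
      · exact contDiffOn_zero.2 (fun z hz ↦ ((hW z hz).2 t ht).2.2) _ hz
    rw [zero_add] at h1
    exact h1.mono_of_mem_nhdsWithin (hs₀n _ hz)
  refine ⟨hC1, fun v w ↦ ?_⟩
  -- Uniqueness of derivatives within the range of the model identifies `W` with `Dφᵗ` read in the
  -- chart.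
  have hderiv : ∀ v : TangentSpace I x, chartDeriv I x₀ (φ t x) (mfderiv I I (φ t) x v) =
      W (e x) t (chartDeriv I x₀ x v) := by
    intro v
    have h1 : HasMFDerivWithinAt 𝓘(ℝ, E) I e.symm (range I) (e x) (chartFrame I x₀ (e x)) :=
      (mdifferentiableWithinAt_extChartAt_symm (hs₀t hz)).hasMFDerivWithinAt
    have hx' : e.symm (e x) = x := e.left_inv hx.1
    have h2 : HasMFDerivAt I I (φ t) (e.symm (e x)) (mfderiv I I (φ t) (e.symm (e x))) := by
      rw [hx']
      exact (hC1.mdifferentiableAt one_ne_zero).hasMFDerivAt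
    have h3 : HasMFDerivAt I 𝓘(ℝ, E) e (φ t (e.symm (e x)))
        (chartDeriv I x₀ (φ t (e.symm (e x)))) := by
      rw [hx']
      exact hasMFDerivAt_chartDeriv hst.1
    have h4 : HasFDerivWithinAt (fun z ↦ e (φ t (e.symm z))) (show E →L[ℝ] E from
        chartDeriv I x₀ (φ t (e.symm (e x))) ∘L
          (mfderiv I I (φ t) (e.symm (e x)) ∘L chartFrame I x₀ (e x))) (range I) (e x) :=
      (HasMFDerivAt.comp_hasMFDerivWithinAt (f := φ t ∘ e.symm) (e x) h3
        (h2.comp_hasMFDerivWithinAt _ h1)).hasFDerivWithinAt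
    have h5 := ((hW _ hz).2 t ht).2.1.mono_of_mem_nhdsWithin (hs₀n _ hz)
    have hu : UniqueDiffWithinAt ℝ (range I) (e x) := I.uniqueDiffOn _ hz.1
    have h6 := hu.eq h5 h4
    rw [h6]
    change _ = chartDeriv I x₀ (φ t (e.symm (e x))) (mfderiv I I (φ t) (e.symm (e x))
      (chartFrame I x₀ (e x) (chartDeriv I x₀ x v)))
    rw [chartFrame_chartDeriv hx.1, hx']
  rw [form_eq_chartForm Ω hst.1, form_eq_chartForm Ω hx.1, ← he, hderiv, hderiv]
  set a : E := chartDeriv I x₀ x v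
  set b : E := chartDeriv I x₀ x w
  set c : ℝ → E := fun t ↦ e (φ t x) with hcdef
  have hxx : e.symm (e x) = x := e.left_inv hx.1
  have hder : ∀ t ∈ Icc 0 τ, HasDerivWithinAt
      (fun t ↦ chartForm Ω x₀ (c t) (W (e x) t a) (W (e x) t b)) 0 (Icc 0 τ) t := by
    intro t ht
    have hct := hstay x hx t ht
    have h1 : HasDerivWithinAt c (chartField X x₀ (c t)) (Icc 0 τ) t :=
      (hasDerivAt_extChartAt_comp ((hφ x).2 t) hct.1).hasDerivWithinAt
    have h4 : ∀ a : E, HasDerivWithinAt (fun t ↦ W (e x) t a) (f' (c t) (W (e x) t a))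
        (Icc 0 τ) t := by
      intro a
      have := ((hW _ hz).2 t ht).1.clm_apply (hasDerivWithinAt_const t (Icc 0 τ) a)
      refine this.congr_deriv ?_
      rw [map_zero, add_zero, hxx]
      rfl
    rw [hf'' _ hct.2] at h4
    exact hasDerivWithinAt_chartForm_apply Ω hH hX (hrs hct.2) h1
      (fun u hu ↦ (hstay x hx u hu).2.2) (h4 a) (h4 b)
  have hconst := constant_of_has_deriv_right_zero (fun t ht ↦ (hder t ht).continuousWithinAt)
    (fun t ht ↦ hasDerivWithinAt_Ici_of_Icc ht (hder t (Ico_subset_Icc_self ht))) t ht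
  simp only [hcdef, (hφ x).1, (hW _ hz).1] at hconst
  exact hconst

end Flow

/-! ### Global properties of the Hamiltonian flow and its tangent flow -/

section GlobalFlow

set_option linter.unusedSectionVars false

open Set Filter

variable {E : Type*} [NormedAddCommGroup E] [NormedSpace ℝ E] [FiniteDimensional ℝ E]
  {A : Type*} [TopologicalSpace A] {I : ModelWithCorners ℝ E A}
  {M : Type*} [TopologicalSpace M] [ChartedSpace A M] [IsManifold I ∞ M]
  {Ω : SymplecticForm I M} {H : M → ℝ} {X : (x : M) → TangentSpace I x} {φ : ℝ → M → M}

/-- `φ` is the flow of the Hamiltonian vector field `X` of the `C²` function `H`. -/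
structure IsHamiltonianFlow (Ω : SymplecticForm I M) (H : M → ℝ)
    (X : (x : M) → TangentSpace I x) (φ : ℝ → M → M) : Prop where
  contMDiff : ContMDiff I 𝓘(ℝ, ℝ) 2 H
  form_eq : ∀ x v, Ω.form x (X x) v = differential I H x v
  flow : IsFlowOf X φ

namespace IsHamiltonianFlow

theorem zero_apply (h : IsHamiltonianFlow Ω H X φ) (x : M) : φ 0 x = x := (h.flow x).1

theorem differential_field (h : IsHamiltonianFlow Ω H X φ) (x : M) :
    differential I H x (X x) = 0 := by
  rw [← h.form_eq, Ω.alternating]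

/-- Time reversal, used to deduce statements for negative times from those for nonnegative times. -/
theorem neg (h : IsHamiltonianFlow Ω H X φ) :
    IsHamiltonianFlow Ω (-H) (fun x ↦ -X x) (fun t ↦ φ (-t)) where
  contMDiff := h.contMDiff.neg
  form_eq x v := by
    have h1 : HasMFDerivAt I 𝓘(ℝ, ℝ) H x (differential I H x) :=
      (h.contMDiff.mdifferentiable (by norm_num) x).hasMFDerivAt
    have h2 : differential I (-H) x = -differential I H x := h1.neg.mfderiv
    rw [h2, map_neg]
    exact congrArg Neg.neg (h.form_eq x v)
  flow x := by
    refine ⟨by simp [h.zero_apply], ?_⟩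
    have := (h.flow x).2.comp_mul (-1)
    convert this using 2
    · simp
    · simp

variable [T2Space M]

theorem add_apply (h : IsHamiltonianFlow Ω H X φ) (s t : ℝ) (x : M) :
    φ (s + t) x = φ s (φ t x) := by
  have h1 : IsMIntegralCurve (fun s ↦ φ (s + t) x) X := (h.flow x).2.comp_add t
  have h2 := isMIntegralCurve_unique (fun x₀ ↦ contDiffOn_chartField Ω h.contMDiff h.form_eq x₀)
    h1 (h.flow (φ t x)).2 (t₀ := 0) (by simp [h.zero_apply])
  exact congrFun h2 s

/-- Finitely many local neighbourhoods cover `M`, which gives one short time valid everywhere.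
Longer times are compositions of short ones. -/
theorem isSymplecticAt_of_nonneg [CompactSpace M] (h : IsHamiltonianFlow Ω H X φ) {t : ℝ}
    (ht : 0 ≤ t) (x : M) : IsSymplecticAt Ω (φ t) x := by
  choose τ hτ U hU hUs using exists_isSymplecticAt_nhds Ω h.contMDiff h.form_eq h.flow
  obtain ⟨F, hF⟩ := isCompact_univ.elim_nhds_subcover U fun x _ ↦ hU x
  obtain ⟨τ₀, hτ₀, hle⟩ : ∃ τ₀ > 0, ∀ y ∈ F, τ₀ ≤ τ y := by
    rcases F.eq_empty_or_nonempty with rfl | hne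
    · exact ⟨1, one_pos, by simp⟩
    · obtain ⟨y, hy, hmin⟩ := F.exists_min_image τ hne
      exact ⟨τ y, hτ y, hmin⟩
  have hsmall : ∀ t ∈ Icc 0 τ₀, ∀ x, IsSymplecticAt Ω (φ t) x := by
    intro t ht x
    obtain ⟨y, hy, hxy⟩ := mem_iUnion₂.1 (hF.2 (mem_univ x))
    exact hUs y t ⟨ht.1, ht.2.trans (hle y hy)⟩ x hxy
  have hadd : ∀ s t, (∀ x, IsSymplecticAt Ω (φ s) x) → (∀ x, IsSymplecticAt Ω (φ t) x) →
      ∀ x, IsSymplecticAt Ω (φ (s + t)) x := by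
    intro s t hs ht x
    have heq : φ (s + t) = φ s ∘ φ t := funext fun x ↦ h.add_apply s t x
    rw [heq]
    refine ⟨(hs (φ t x)).1.comp x (ht x).1, fun v w ↦ ?_⟩
    rw [mfderiv_comp x ((hs (φ t x)).1.mdifferentiableAt one_ne_zero)
      ((ht x).1.mdifferentiableAt one_ne_zero)]
    exact ((hs (φ t x)).2 _ _).trans ((ht x).2 v w)
  have hind : ∀ n : ℕ, ∀ t ∈ Icc 0 (n * τ₀), ∀ x, IsSymplecticAt Ω (φ t) x := by
    intro n
    induction n with
    | zero =>
      intro t ht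
      exact hsmall t ⟨ht.1, by simpa using ht.2.trans (by simp [hτ₀.le])⟩
    | succ n ih =>
      intro t ht
      rcases le_total t τ₀ with h1 | h1
      · exact hsmall t ⟨ht.1, h1⟩
      · have := hadd τ₀ (t - τ₀) (hsmall τ₀ ⟨hτ₀.le, le_rfl⟩)
          (ih (t - τ₀) ⟨by linarith, by have := ht.2; push_cast at this; linarith⟩)
        rwa [add_sub_cancel] at this
  obtain ⟨n, hn⟩ := exists_nat_ge (t / τ₀)
  exact hind n t ⟨ht, (div_le_iff₀ hτ₀).1 hn⟩ x

/-- The time-`t` map of a Hamiltonian flow is a `C¹` map preserving the symplectic form. -/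
theorem isSymplecticAt [CompactSpace M] (h : IsHamiltonianFlow Ω H X φ) (t : ℝ) (x : M) :
    IsSymplecticAt Ω (φ t) x := by
  rcases le_total 0 t with ht | ht
  · exact h.isSymplecticAt_of_nonneg ht x
  · simpa using h.neg.isSymplecticAt_of_nonneg (t := -t) (by linarith) x

variable [CompactSpace M]

theorem contMDiff_flow (h : IsHamiltonianFlow Ω H X φ) (t : ℝ) : ContMDiff I I 1 (φ t) :=
  fun x ↦ (h.isSymplecticAt t x).1

theorem mdifferentiableAt_flow (h : IsHamiltonianFlow Ω H X φ) (t : ℝ) (x : M) :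
    MDifferentiableAt I I (φ t) x :=
  (h.isSymplecticAt t x).1.mdifferentiableAt one_ne_zero

theorem form_tangentFlow (h : IsHamiltonianFlow Ω H X φ) (t : ℝ) (x : M) (v w : TangentSpace I x) :
    Ω.form (φ t x) (tangentFlow I φ t x v) (tangentFlow I φ t x w) = Ω.form x v w :=
  (h.isSymplecticAt t x).2 v w

/-- The chain rule for the group law. The two sides live over base points that are equal but not
definitionally so; hence the comparison in the model space `E`. -/
theorem tangentFlow_add (h : IsHamiltonianFlow Ω H X φ) (s t : ℝ) (x : M) (v : TangentSpace I x) :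
    (tangentFlow I φ (s + t) x v : E) = tangentFlow I φ s (φ t x) (tangentFlow I φ t x v) := by
  have heq : φ (s + t) = φ s ∘ φ t := funext fun x ↦ h.add_apply s t x
  unfold tangentFlow
  rw [heq, mfderiv_comp x (h.mdifferentiableAt_flow s _) (h.mdifferentiableAt_flow t x)]
  rfl

theorem tangentFlow_zero (h : IsHamiltonianFlow Ω H X φ) (x : M) (v : TangentSpace I x) :
    (tangentFlow I φ 0 x v : E) = v := by
  have heq : φ 0 = id := funext fun x ↦ h.zero_apply x
  unfold tangentFlow
  rw [heq, mfderiv_id]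
  rfl

theorem tangentFlow_neg_apply (h : IsHamiltonianFlow Ω H X φ) (t : ℝ) (x : M)
    (v : TangentSpace I x) :
    (tangentFlow I φ (-t) (φ t x) (tangentFlow I φ t x v) : E) = v := by
  rw [← h.tangentFlow_add, neg_add_cancel, h.tangentFlow_zero]

theorem tangentFlow_injective (h : IsHamiltonianFlow Ω H X φ) (t : ℝ) (x : M) :
    Function.Injective (tangentFlow I φ t x) := fun v w hvw ↦ by
  have h1 := h.tangentFlow_neg_apply t x v
  rw [hvw, h.tangentFlow_neg_apply] at h1
  exact h1.symm

/-- The curve `s ↦ φᵗ(φˢ x)` is an integral curve of `X`; its velocity at `s = 0` is also given by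
the chain rule. -/
theorem tangentFlow_field (h : IsHamiltonianFlow Ω H X φ) (t : ℝ) (x : M) :
    tangentFlow I φ t x (X x) = X (φ t x) := by
  have h1 : IsMIntegralCurve (fun s ↦ φ t (φ s x)) X := by
    have := (h.flow x).2.comp_add t
    convert this using 1
    funext s
    simp only [Function.comp_apply]
    rw [add_comm, h.add_apply]
  have h2 : HasMFDerivAt 𝓘(ℝ, ℝ) I (φ t ∘ fun s ↦ φ s x) 0
      (mfderiv I I (φ t) (φ 0 x) ∘L (1 : ℝ →L[ℝ] ℝ).smulRight (X (φ 0 x))) :=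
    HasMFDerivAt.comp 0 (h.mdifferentiableAt_flow t (φ 0 x)).hasMFDerivAt ((h.flow x).2 0)
  have h3 : (mfderiv I I (φ t) (φ 0 x) ((1 : ℝ) • X (φ 0 x)) : E) =
      ((1 : ℝ) • X (φ t (φ 0 x)) : TangentSpace I (φ t (φ 0 x))) :=
    congrArg (fun L : ℝ →L[ℝ] E ↦ L 1) (hasMFDerivAt_unique h2 (h1 0))
  rw [one_smul, one_smul, h.zero_apply] at h3
  exact h3

theorem energy (h : IsHamiltonianFlow Ω H X φ) (t : ℝ) (x : M) : H (φ t x) = H x := by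
  have h1 : ∀ t, HasDerivAt (fun t ↦ H (φ t x)) 0 t := by
    intro t
    have h2 : HasMFDerivAt I 𝓘(ℝ, ℝ) H (φ t x) (differential I H (φ t x)) :=
      (h.contMDiff.mdifferentiable (by norm_num) _).hasMFDerivAt
    have h3 : HasFDerivAt (fun t ↦ H (φ t x))
        (show ℝ →L[ℝ] ℝ from differential I H (φ t x) ∘L (1 : ℝ →L[ℝ] ℝ).smulRight (X (φ t x))) t :=
      (HasMFDerivAt.comp t h2 ((h.flow x).2 t)).hasFDerivAt
    refine h3.hasDerivAt.congr_deriv ?_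
    change differential I H (φ t x) ((1 : ℝ) • X (φ t x)) = 0
    rw [one_smul, h.differential_field]
  have h4 := is_const_of_deriv_eq_zero (fun t ↦ (h1 t).differentiableAt) (fun t ↦ (h1 t).deriv) t 0
  simpa [h.zero_apply] using h4

theorem differential_tangentFlow (h : IsHamiltonianFlow Ω H X φ) (t : ℝ) (x : M)
    (v : TangentSpace I x) :
    differential I H (φ t x) (tangentFlow I φ t x v) = differential I H x v := by
  have heq : H ∘ φ t = H := funext fun x ↦ h.energy t x
  have h1 : mfderiv I 𝓘(ℝ, ℝ) (H ∘ φ t) x = _ :=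
    mfderiv_comp x (h.contMDiff.mdifferentiable (by norm_num) _) (h.mdifferentiableAt_flow t x)
  rw [heq] at h1
  unfold differential tangentFlow
  rw [h1]
  rfl

theorem continuous_tangentFlow (h : IsHamiltonianFlow Ω H X φ) (t : ℝ) :
    Continuous fun p : TangentBundle I M ↦
      (⟨φ t p.proj, tangentFlow I φ t p.proj p.2⟩ : TangentBundle I M) :=
  (h.contMDiff_flow t).continuous_tangentMap le_rfl

end IsHamiltonianFlow

end GlobalFlow

/-! ### Continuity over fibres and compactness arguments -/

section FibreContinuity

set_option linter.unusedSectionVars false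

open Set Filter

variable {E : Type*} [NormedAddCommGroup E] [NormedSpace ℝ E] [FiniteDimensional ℝ E]
  {A : Type*} [TopologicalSpace A] {I : ModelWithCorners ℝ E A}
  {M : Type*} [TopologicalSpace M] [ChartedSpace A M] [IsManifold I ∞ M]

/-- The frame of the tangent bundle given by the trivialization at `x₀`. -/
def frameAt (I : ModelWithCorners ℝ E A) {M : Type*} [TopologicalSpace M] [ChartedSpace A M]
    [IsManifold I ∞ M] (x₀ y : M) : E →L[ℝ] TangentSpace I y :=
  (trivializationAt E (TangentSpace I : M → Type _) x₀).symmL ℝ y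

/-- The points and pairs of coordinates over the domain of the trivialization at `x₀`. -/
def frameDomain (I : ModelWithCorners ℝ E A) {M : Type*} [TopologicalSpace M] [ChartedSpace A M]
    [IsManifold I ∞ M] (x₀ : M) : Set (M × E × E) :=
  (trivializationAt E (TangentSpace I : M → Type _) x₀).baseSet ×ˢ univ

/-- A real function of a point and two tangent vectors is continuous. -/
def FibreContinuous (F : (x : M) → TangentSpace I x → TangentSpace I x → ℝ) : Prop :=
  ∀ x₀ : M, ContinuousOn (fun q : M × E × E ↦ F q.1 (frameAt I x₀ q.1 q.2.1)
    (frameAt I x₀ q.1 q.2.2)) (frameDomain I x₀)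

/-- A tangent vector depending on a point and two tangent vectors is continuous. -/
def FibreContinuousVec (b : M → M)
    (V : (x : M) → TangentSpace I x → TangentSpace I x → TangentSpace I (b x)) : Prop :=
  ∀ x₀ : M, ContinuousOn (fun q : M × E × E ↦ (⟨b q.1, V q.1 (frameAt I x₀ q.1 q.2.1)
    (frameAt I x₀ q.1 q.2.2)⟩ : TangentBundle I M)) (frameDomain I x₀)

theorem frameAt_eq_symm {x₀ y : M}
    (hy : y ∈ (trivializationAt E (TangentSpace I : M → Type _) x₀).baseSet) (v : E) :
    frameAt I x₀ y v = (trivializationAt E (TangentSpace I : M → Type _) x₀).symm y v :=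
  Trivialization.symmL_apply (R := ℝ) _ hy v

theorem exists_frameAt_eq {x₀ y : M}
    (hy : y ∈ (trivializationAt E (TangentSpace I : M → Type _) x₀).baseSet)
    (v : TangentSpace I y) : ∃ c : E, frameAt I x₀ y c = v :=
  ⟨_, Trivialization.symmL_continuousLinearMapAt (R := ℝ) _ hy v⟩

theorem frameAt_ne_zero {x₀ y : M}
    (hy : y ∈ (trivializationAt E (TangentSpace I : M → Type _) x₀).baseSet)
    {v : E} (hv : v ≠ 0) : frameAt I x₀ y v ≠ 0 := by
  intro h
  have h1 := Trivialization.continuousLinearMapAt_symmL (R := ℝ)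
    (trivializationAt E (TangentSpace I : M → Type _) x₀) hy v
  change Trivialization.continuousLinearMapAt ℝ _ y (frameAt I x₀ y v) = v at h1
  rw [h, map_zero] at h1
  exact hv h1.symm

theorem fibreContinuousVec_fst : FibreContinuousVec (I := I) (M := M) id fun _ v _ ↦ v := by
  intro x₀
  have h1 := (trivializationAt E (TangentSpace I : M → Type _) x₀).continuousOn_symm
  have h2 : ContinuousOn (fun q : M × E × E ↦ (q.1, q.2.1)) (frameDomain I x₀) := by fun_prop
  refine (h1.comp h2 fun q hq ↦ ⟨hq.1, mem_univ _⟩).congr fun q hq ↦ ?_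
  simp only [Function.comp_apply, id]
  rw [frameAt_eq_symm hq.1]

theorem fibreContinuousVec_snd : FibreContinuousVec (I := I) (M := M) id fun _ _ v ↦ v := by
  intro x₀
  have h1 := (trivializationAt E (TangentSpace I : M → Type _) x₀).continuousOn_symm
  have h2 : ContinuousOn (fun q : M × E × E ↦ (q.1, q.2.2)) (frameDomain I x₀) := by fun_prop
  refine (h1.comp h2 fun q hq ↦ ⟨hq.1, mem_univ _⟩).congr fun q hq ↦ ?_
  simp only [Function.comp_apply, id]
  rw [frameAt_eq_symm hq.1]

theorem FibreContinuousVec.map {V : (x : M) → TangentSpace I x → TangentSpace I x →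
    TangentSpace I x} (hV : FibreContinuousVec id V) {b : M → M}
    {D : (x : M) → TangentSpace I x →L[ℝ] TangentSpace I (b x)}
    (hD : Continuous fun p : TangentBundle I M ↦ (⟨b p.proj, D p.proj p.2⟩ : TangentBundle I M)) :
    FibreContinuousVec b fun x v w ↦ D x (V x v w) :=
  fun x₀ ↦ hD.comp_continuousOn (hV x₀)

theorem fibreContinuousVec_field {X : (x : M) → TangentSpace I x}
    (hX : Continuous fun x ↦ (⟨x, X x⟩ : TangentBundle I M)) {b : M → M} (hb : Continuous b) :
    FibreContinuousVec b fun x _ _ ↦ X (b x) :=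
  fun _ ↦ (hX.comp (hb.comp continuous_fst)).continuousOn

theorem FibreContinuousVec.form {V W : (x : M) → TangentSpace I x → TangentSpace I x →
    TangentSpace I x} (hV : FibreContinuousVec id V) (hW : FibreContinuousVec id W)
    (Ω : SymplecticForm I M) : FibreContinuous fun x v w ↦ Ω.form x (V x v w) (W x v w) := by
  intro x₀
  have h1 : ContinuousOn (fun q : M × E × E ↦ TotalSpace.mk' (E →L[ℝ] E →L[ℝ] ℝ)
      (E := fun x : M ↦ TangentSpace I x →L[ℝ] TangentSpace I x →L[ℝ] ℝ) (id q.1)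
      (Ω.form (id q.1))) (frameDomain I x₀) :=
    (Ω.smooth.continuous.comp continuous_fst).continuousOn
  have h2 := ContinuousOn.clm_bundle_apply₂ (E₃ := fun _ : M ↦ ℝ) (F₃ := ℝ) h1 (hV x₀) (hW x₀)
  intro q hq
  have h3 := h2 q hq
  rw [FiberBundle.continuousWithinAt_totalSpace] at h3
  exact h3.2

/-- The chart expression of `X` is continuous, and the inverse trivialization turns it back into the
section. -/
theorem continuous_hamiltonianField {Ω : SymplecticForm I M} {H : M → ℝ}
    (hH : ContMDiff I 𝓘(ℝ, ℝ) 2 H) {X : (x : M) → TangentSpace I x}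
    (hX : ∀ x v, Ω.form x (X x) v = differential I H x v) :
    Continuous fun x ↦ (⟨x, X x⟩ : TangentBundle I M) := by
  rw [continuous_iff_continuousAt]
  intro x₀
  set e := trivializationAt E (TangentSpace I : M → Type _) x₀ with he
  have hbase : e.baseSet = (extChartAt I x₀).source := by
    rw [he, TangentBundle.trivializationAt_baseSet, extChartAt_source]
  have hmem : e.baseSet ∈ 𝓝 x₀ := e.open_baseSet.mem_nhds (mem_baseSet_trivializationAt E _ x₀)
  have h1 : ContinuousOn (fun x ↦ chartField X x₀ (extChartAt I x₀ x)) e.baseSet := by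
    rw [hbase]
    exact (contDiffOn_chartField Ω hH hX x₀).continuousOn.comp (continuousOn_extChartAt x₀)
      fun x hx ↦ (extChartAt I x₀).map_source hx
  have h2 : ContinuousOn (fun x ↦ (x, chartField X x₀ (extChartAt I x₀ x))) e.baseSet :=
    continuousOn_id.prodMk h1
  have h3 := e.continuousOn_symm.comp h2 fun x hx ↦ ⟨hx, mem_univ _⟩
  refine ContinuousOn.continuousAt (h3.congr fun x hx ↦ ?_) hmem
  have hx' : x ∈ (extChartAt I x₀).source := hbase ▸ hx
  simp only [Function.comp_apply]
  have h4 : (e.symm x (chartField X x₀ (extChartAt I x₀ x)) : TangentSpace I x) = X x := by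
    rw [← Trivialization.symmL_apply (R := ℝ) _ hx,
      TangentBundle.symmL_trivializationAt (by simpa only [extChartAt_source] using hx')]
    have h5 : chartField X x₀ (extChartAt I x₀ x) = chartDeriv I x₀ x (X x) := by
      unfold chartField
      rw [(extChartAt I x₀).left_inv hx']
      rfl
    rw [h5]
    exact chartFrame_chartDeriv hx' (X x)
  rw [h4]

namespace FibreContinuous

variable {F G : (x : M) → TangentSpace I x → TangentSpace I x → ℝ}

theorem add (hF : FibreContinuous F) (hG : FibreContinuous G) :
    FibreContinuous fun x v w ↦ F x v w + G x v w :=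
  fun x₀ ↦ (hF x₀).add (hG x₀)

theorem sub (hF : FibreContinuous F) (hG : FibreContinuous G) :
    FibreContinuous fun x v w ↦ F x v w - G x v w :=
  fun x₀ ↦ (hF x₀).sub (hG x₀)

theorem mul (hF : FibreContinuous F) (hG : FibreContinuous G) :
    FibreContinuous fun x v w ↦ F x v w * G x v w :=
  fun x₀ ↦ (hF x₀).mul (hG x₀)

theorem const_mul (hF : FibreContinuous F) (c : ℝ) : FibreContinuous fun x v w ↦ c * F x v w :=
  fun x₀ ↦ (hF x₀).const_mul c

theorem abs (hF : FibreContinuous F) : FibreContinuous fun x v w ↦ |F x v w| :=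
  fun x₀ ↦ (hF x₀).abs

theorem sqrt (hF : FibreContinuous F) : FibreContinuous fun x v w ↦ √(F x v w) :=
  fun x₀ ↦ (hF x₀).sqrt

theorem posPart (hF : FibreContinuous F) : FibreContinuous fun x v w ↦ max 0 (F x v w) :=
  fun x₀ ↦ continuousOn_const.sup (hF x₀)

end FibreContinuous

/-- Homogeneity of degree one in each of two vectors. -/
def Bihomogeneous (F : (x : M) → TangentSpace I x → TangentSpace I x → ℝ) : Prop :=
  ∀ x v w (a b : ℝ), F x (a • v) (b • w) = |a| * |b| * F x v w

/-- Comparison of continuous bihomogeneous functions over a compact set. -/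
theorem exists_bound_of_bihomogeneous [T2Space M] [CompactSpace M] {K : Set M} (hK : IsClosed K)
    {F G : (x : M) → TangentSpace I x → TangentSpace I x → ℝ} (hF : FibreContinuous F)
    (hG : FibreContinuous G) (hFh : Bihomogeneous F) (hGh : Bihomogeneous G)
    (hpos : ∀ x ∈ K, ∀ v w : TangentSpace I x, v ≠ 0 → w ≠ 0 → 0 < G x v w) :
    ∃ C > 0, ∀ x ∈ K, ∀ v w : TangentSpace I x, F x v w ≤ C * G x v w := by
  have hGnn : ∀ x ∈ K, ∀ v w : TangentSpace I x, 0 ≤ G x v w := by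
    intro x hx v w
    have hz : ∀ v w : TangentSpace I x, (v = 0 ∨ w = 0) → G x v w = 0 := by
      rintro v w (rfl | rfl)
      · simpa using hGh x 0 w 0 1
      · simpa using hGh x v 0 1 0
    by_cases h : v = 0 ∨ w = 0
    · exact (hz v w h).ge
    · rw [not_or] at h
      exact (hpos x hx v w h.1 h.2).le
  suffices h : ∃ C > 0, ∀ x ∈ K ∩ K, ∀ v w : TangentSpace I x, F x v w ≤ C * G x v w by
    simpa using h
  refine hK.isCompact.induction_on
    (p := fun s ↦ ∃ C > 0, ∀ x ∈ s ∩ K, ∀ v w : TangentSpace I x, F x v w ≤ C * G x v w)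
    ⟨1, one_pos, by simp⟩ ?_ ?_ ?_
  · rintro s t hst ⟨C, hC, h⟩
    exact ⟨C, hC, fun x hx ↦ h x ⟨hst hx.1, hx.2⟩⟩
  · rintro s t ⟨C, hC, h⟩ ⟨C', hC', h'⟩
    refine ⟨max C C', lt_max_of_lt_left hC, ?_⟩
    rintro x ⟨hx | hx, hxK⟩ v w
    · exact (h x ⟨hx, hxK⟩ v w).trans
        (mul_le_mul_of_nonneg_right (le_max_left _ _) (hGnn x hxK v w))
    · exact (h' x ⟨hx, hxK⟩ v w).trans
        (mul_le_mul_of_nonneg_right (le_max_right _ _) (hGnn x hxK v w))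
  intro x₀ _
  have : ProperSpace E := FiniteDimensional.proper ℝ E
  set e := trivializationAt E (TangentSpace I : M → Type _) x₀ with he
  obtain ⟨V, hV, hVc, hVe⟩ := exists_mem_nhds_isClosed_subset
    (e.open_baseSet.mem_nhds (mem_baseSet_trivializationAt E _ x₀))
  -- By bihomogeneity it is enough to bound `F / G` on pairs of unit coordinate vectors, which form
  -- a compact set over `V ∩ K`.
  set S : Set (M × E × E) := (V ∩ K) ×ˢ (Metric.sphere (0 : E) 1 ×ˢ Metric.sphere (0 : E) 1)
    with hS
  have hSc : IsCompact S :=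
    (hVc.inter hK).isCompact.prod ((isCompact_sphere _ _).prod (isCompact_sphere _ _))
  have hSd : S ⊆ frameDomain I x₀ := fun q hq ↦ ⟨hVe hq.1.1, mem_univ _⟩
  have hne : ∀ v ∈ Metric.sphere (0 : E) 1, v ≠ 0 := fun v hv h ↦ by
    rw [h] at hv; simp at hv
  have hposS : ∀ q ∈ S, 0 < G q.1 (frameAt I x₀ q.1 q.2.1) (frameAt I x₀ q.1 q.2.2) :=
    fun q hq ↦ hpos _ hq.1.2 _ _ (frameAt_ne_zero (hVe hq.1.1) (hne _ hq.2.1))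
      (frameAt_ne_zero (hVe hq.1.1) (hne _ hq.2.2))
  have hcont : ContinuousOn (fun q : M × E × E ↦
      F q.1 (frameAt I x₀ q.1 q.2.1) (frameAt I x₀ q.1 q.2.2) /
        G q.1 (frameAt I x₀ q.1 q.2.1) (frameAt I x₀ q.1 q.2.2)) S :=
    ((hF x₀).mono hSd).div ((hG x₀).mono hSd) fun q hq ↦ (hposS q hq).ne'
  obtain ⟨C, hC⟩ := hSc.exists_bound_of_continuousOn hcont
  refine ⟨V ∩ K, inter_comm V K ▸ inter_mem_nhdsWithin K hV, max C 1,
    lt_max_of_lt_right one_pos, ?_⟩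
  rintro x ⟨⟨hxV, hxK⟩, -⟩ v w
  obtain ⟨a, rfl⟩ := exists_frameAt_eq (hVe hxV) v
  obtain ⟨b, rfl⟩ := exists_frameAt_eq (hVe hxV) w
  by_cases ha : a = 0
  · have h1 : ∀ F : (x : M) → TangentSpace I x → TangentSpace I x → ℝ, Bihomogeneous F →
        F x (frameAt I x₀ x a) (frameAt I x₀ x b) = 0 := fun F hF ↦ by
      rw [ha, map_zero]
      simpa using hF x 0 (frameAt I x₀ x b) 0 1
    rw [h1 F hFh, h1 G hGh, mul_zero]
  by_cases hb : b = 0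
  · have h1 : ∀ F : (x : M) → TangentSpace I x → TangentSpace I x → ℝ, Bihomogeneous F →
        F x (frameAt I x₀ x a) (frameAt I x₀ x b) = 0 := fun F hF ↦ by
      rw [hb, map_zero]
      simpa using hF x (frameAt I x₀ x a) 0 1 0
    rw [h1 F hFh, h1 G hGh, mul_zero]
  have hnorm : ∀ a : E, a ≠ 0 → ‖a‖⁻¹ • a ∈ Metric.sphere (0 : E) 1 := fun a ha ↦ by
    simp [norm_smul, ha]
  have hrep : ∀ a : E, a ≠ 0 → frameAt I x₀ x a = ‖a‖ • frameAt I x₀ x (‖a‖⁻¹ • a) := by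
    intro a ha
    rw [← map_smul, smul_smul, mul_inv_cancel₀ (norm_ne_zero_iff.2 ha), one_smul]
  have hq : (x, ‖a‖⁻¹ • a, ‖b‖⁻¹ • b) ∈ S := ⟨⟨hxV, hxK⟩, hnorm a ha, hnorm b hb⟩
  have h1 := (le_abs_self _).trans ((hC _ hq).trans (le_max_left C 1))
  rw [div_le_iff₀ (hposS _ hq)] at h1
  rw [hrep a ha, hrep b hb, hFh, hGh]
  calc |‖a‖| * |‖b‖| * _ ≤ |‖a‖| * |‖b‖| * _ := mul_le_mul_of_nonneg_left h1 (by positivity)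
    _ = _ := by ring

/-- Closed homogeneous conditions that have a nonzero solution over `Λ` have a nonzero solution
over the closure of `Λ`. -/
theorem exists_ne_zero_of_mem_closure {Λ : Set M} {ι : Type*}
    {f : ι → (x : M) → TangentSpace I x → ℝ} (hf : ∀ i, FibreContinuous fun x v _ ↦ f i x v)
    (hfh : ∀ i x (v : TangentSpace I x) (a : ℝ), f i x (a • v) = |a| * f i x v)
    (hΛ : ∀ x ∈ Λ, ∃ v : TangentSpace I x, v ≠ 0 ∧ ∀ i, f i x v ≤ 0) {x₀ : M}
    (hx₀ : x₀ ∈ closure Λ) : ∃ v : TangentSpace I x₀, v ≠ 0 ∧ ∀ i, f i x₀ v ≤ 0 := by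
  have : ProperSpace E := FiniteDimensional.proper ℝ E
  set e := trivializationAt E (TangentSpace I : M → Type _) x₀ with he
  have hx₀e : x₀ ∈ e.baseSet := mem_baseSet_trivializationAt E _ x₀
  have hex : ∀ y, ∃ c : E, y ∈ Λ ∩ e.baseSet →
      c ∈ Metric.sphere (0 : E) 1 ∧ ∀ i, f i y (frameAt I x₀ y c) ≤ 0 := by
    intro y
    by_cases hy : y ∈ Λ ∩ e.baseSet
    · obtain ⟨v, hv, hvi⟩ := hΛ y hy.1
      obtain ⟨c, rfl⟩ := exists_frameAt_eq hy.2 v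
      have hc : c ≠ 0 := fun h ↦ hv (by rw [h, map_zero])
      refine ⟨‖c‖⁻¹ • c, fun _ ↦ ⟨by simp [norm_smul, hc], fun i ↦ ?_⟩⟩
      rw [map_smul, hfh]
      exact mul_nonpos_of_nonneg_of_nonpos (abs_nonneg _) (hvi i)
    · exact ⟨0, fun h ↦ absurd h hy⟩
  choose c hc using hex
  have hne : (𝓝[Λ] x₀).NeBot := mem_closure_iff_nhdsWithin_neBot.1 hx₀
  -- Along an ultrafilter converging to `x₀` within `Λ`, the normalised coordinates converge on the
  -- unit sphere, so the limit vector is nonzero.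
  set u : Ultrafilter M := Ultrafilter.of (𝓝[Λ] x₀)
  have hu : (u : Filter M) ≤ 𝓝[Λ] x₀ := Ultrafilter.of_le _
  have hmem : ∀ᶠ y in (u : Filter M), y ∈ Λ ∩ e.baseSet :=
    hu (inter_mem self_mem_nhdsWithin
      (mem_nhdsWithin_of_mem_nhds (e.open_baseSet.mem_nhds hx₀e)))
  obtain ⟨c₀, hc₀, hlim⟩ := (isCompact_sphere (0 : E) 1).ultrafilter_le_nhds (u.map c) (by
    rw [Filter.le_principal_iff]
    change ∀ᶠ y in (u : Filter M), c y ∈ Metric.sphere (0 : E) 1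
    filter_upwards [hmem] with y hy using (hc y hy).1)
  have hc₀ne : c₀ ≠ 0 := fun h ↦ by rw [h] at hc₀; simp at hc₀
  refine ⟨frameAt I x₀ x₀ c₀, frameAt_ne_zero hx₀e hc₀ne, fun i ↦ ?_⟩
  have hcont := hf i x₀ (x₀, c₀, c₀) ⟨hx₀e, mem_univ _⟩
  have ht : Tendsto (fun y ↦ (y, c y, c y)) u (𝓝[frameDomain I x₀] (x₀, c₀, c₀)) := by
    refine tendsto_nhdsWithin_iff.2 ⟨?_, ?_⟩
    · have h1 : Tendsto id (u : Filter M) (𝓝 x₀) := hu.trans nhdsWithin_le_nhds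
      exact h1.prodMk_nhds (Tendsto.prodMk_nhds hlim hlim)
    · filter_upwards [hmem] with y hy using ⟨hy.2, mem_univ _⟩
  refine le_of_tendsto (hcont.tendsto.comp ht) ?_
  filter_upwards [hmem] with y hy using (hc y hy).2 i

variable [RiemannianBundle (fun x : M ↦ TangentSpace I x)]
  [IsContinuousRiemannianBundle E (fun x : M ↦ TangentSpace I x)]

theorem FibreContinuousVec.inner {b : M → M}
    {V W : (x : M) → TangentSpace I x → TangentSpace I x → TangentSpace I (b x)}
    (hV : FibreContinuousVec b V) (hW : FibreContinuousVec b W) :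
    FibreContinuous fun x v w ↦ inner ℝ (V x v w) (W x v w) :=
  fun x₀ ↦ (hV x₀).inner_bundle (hW x₀)

theorem FibreContinuousVec.norm {b : M → M}
    {V : (x : M) → TangentSpace I x → TangentSpace I x → TangentSpace I (b x)}
    (hV : FibreContinuousVec b V) : FibreContinuous fun x v w ↦ ‖V x v w‖ := by
  simp only [norm_eq_sqrt_real_inner]
  exact (hV.inner hV).sqrt

end FibreContinuity

/-! ### Linear algebra and estimates for sequences -/

section LinearAlgebra

/-- Three independent vectors in the kernel of a nonzero linear form on a four-dimensional space
span this kernel. -/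
theorem exists_eq_of_mem_ker {V : Type*} [AddCommGroup V] [Module ℝ V]
    (hV : Module.finrank ℝ V = 4) {l : V →ₗ[ℝ] ℝ} (hl : l ≠ 0) {v₁ v₂ v₃ : V}
    (h₁ : l v₁ = 0) (h₂ : l v₂ = 0) (h₃ : l v₃ = 0)
    (hind : ∀ a b c : ℝ, a • v₁ + b • v₂ + c • v₃ = 0 → a = 0 ∧ b = 0 ∧ c = 0) {z : V}
    (hz : l z = 0) : ∃ a b c : ℝ, z = a • v₁ + b • v₂ + c • v₃ := by
  have : FiniteDimensional ℝ V := Module.finite_of_finrank_pos (by omega)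
  have hli : LinearIndependent ℝ ![v₁, v₂, v₃] := by
    rw [Fintype.linearIndependent_iff]
    intro g hg
    rw [Fin.sum_univ_three] at hg
    obtain ⟨h0, h1, h2⟩ := hind _ _ _ hg
    intro i
    fin_cases i <;> assumption
  have hle : Submodule.span ℝ (Set.range ![v₁, v₂, v₃]) ≤ LinearMap.ker l := by
    rw [Submodule.span_le]
    rintro _ ⟨i, rfl⟩
    fin_cases i <;> assumption
  have hrank := Module.Dual.finrank_ker_add_one_of_ne_zero (f := l) hl
  have heq := Submodule.eq_of_le_of_finrank_eq hle (by
    rw [finrank_span_eq_card hli, Fintype.card_fin]; omega)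
  have hz' : z ∈ Submodule.span ℝ (Set.range ![v₁, v₂, v₃]) := by
    rw [heq]; exact hz
  obtain ⟨c, hc⟩ := (Submodule.mem_span_range_iff_exists_fun ℝ).1 hz'
  rw [Fin.sum_univ_three] at hc
  exact ⟨c 0, c 1, c 2, hc.symm⟩

/-- Increments bounded by an exponentially decaying sequence sum up. -/
theorem exists_limit_of_decay {a α : ℤ → ℝ} {B C l : ℝ} (hl : l < 1) (hC : 0 ≤ C)
    (ha : ∀ (j : ℤ) (k : ℕ), a (j + k) ≤ B * l ^ k * a j)
    (hα : ∀ j, |α (j + 1) - α j| ≤ C * a j) :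
    ∃ L, ∀ j, |α j - L| ≤ C * B / (1 - l) * a j := by
  have hdist : ∀ (j : ℤ) (k : ℕ),
      dist (α (j + k)) (α (j + (k + 1 : ℕ))) ≤ C * B * a j * l ^ k := by
    intro j k
    have h1 := (hα (j + k)).trans (mul_le_mul_of_nonneg_left (ha j k) hC)
    rw [dist_comm, Real.dist_eq]
    push_cast
    rw [← add_assoc]
    linarith
  have hlim : ∀ j : ℤ, ∃ L, Filter.Tendsto (fun k : ℕ ↦ α (j + k)) Filter.atTop (𝓝 L) :=
    fun j ↦ cauchySeq_tendsto_of_complete (cauchySeq_of_le_geometric l _ hl (hdist j))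
  choose L hL using hlim
  -- The sequences starting at `j` and at `j + 1` are shifts of each other, so a single limit serves
  -- all `j`.
  have hstep : ∀ j, L (j + 1) = L j := by
    intro j
    refine tendsto_nhds_unique (hL (j + 1)) ?_
    refine ((Filter.tendsto_add_atTop_iff_nat 1).2 (hL j)).congr fun k ↦ ?_
    congr 1
    push_cast
    ring
  have hconst : ∀ j, L j = L 0 := by
    intro j
    induction j using Int.induction_on with
    | zero => rfl
    | succ i ih => rw [hstep, ih]
    | pred i ih => rw [← hstep, sub_add_cancel, ih]
  refine ⟨L 0, fun j ↦ ?_⟩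
  have h1 := dist_le_of_le_geometric_of_tendsto₀ l _ hl (hdist j) (hL j)
  rw [hconst j, Real.dist_eq] at h1
  simp only [Nat.cast_zero, add_zero] at h1
  calc _ ≤ _ := h1
    _ = _ := by ring

/-- Domination and bounded areas give contraction. -/
theorem sq_le_of_domination {a b : ℤ → ℝ} {B : ℝ} (ha : ∀ j, 0 < a j) (hb : ∀ j, 0 < b j)
    (hB : ∀ i j, a i * b i ≤ B * (a j * b j))
    (hdom : ∀ j, 2 * (a (j + 1) * b j) ≤ b (j + 1) * a j) (j : ℤ) (k : ℕ) :
    a (j + k) ^ 2 ≤ B * (1 / 2) ^ k * a j ^ 2 ∧ b j ^ 2 ≤ B * (1 / 2) ^ k * b (j + k) ^ 2 := by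
  -- Iterated domination. Multiplied by the area bound `hB`, taken in one direction or the other, it
  -- leaves the square of `a` or of `b` after cancelling the common factors.
  have hiter : a (j + k) * b j ≤ (1 / 2) ^ k * (b (j + k) * a j) := by
    induction k with
    | zero => simp [mul_comm]
    | succ k ih =>
      have h1 := hdom (j + k)
      have hbk := hb (j + k)
      have hcast : j + (k + 1 : ℕ) = j + k + 1 := by push_cast; ring
      rw [hcast]
      refine le_of_mul_le_mul_right ?_ hbk
      have h2 := mul_le_mul_of_nonneg_left ih (hb (j + k + 1)).le
      have h3 := mul_le_mul_of_nonneg_right h1 (hb j).le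
      rw [pow_succ]
      nlinarith
  have hB1 := hB (j + k) j
  have hB2 := hB j (j + k)
  have h0 := ha j
  have h0' := hb j
  have h1 := ha (j + k)
  have h1' := hb (j + k)
  have hp : (0 : ℝ) < (1 / 2) ^ k := by positivity
  constructor
  · refine le_of_mul_le_mul_right ?_ (mul_pos h0' h1')
    calc _ = (a (j + k) * b j) * (a (j + k) * b (j + k)) := by ring
      _ ≤ ((1 / 2) ^ k * (b (j + k) * a j)) * (B * (a j * b j)) :=
        mul_le_mul hiter hB1 (by positivity) (by positivity)
      _ = _ := by ring
  · refine le_of_mul_le_mul_right ?_ (mul_pos h0 h1)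
    calc _ = (a (j + k) * b j) * (a j * b j) := by ring
      _ ≤ ((1 / 2) ^ k * (b (j + k) * a j)) * (B * (a (j + k) * b (j + k))) :=
        mul_le_mul hiter hB2 (by positivity) (by positivity)
      _ = _ := by ring

end LinearAlgebra

/-! ### Cocycle and area identities for the transversal linear Poincaré flow -/

section Transversal

set_option linter.unusedSectionVars false

open Set Filter

variable {E : Type*} [NormedAddCommGroup E] [NormedSpace ℝ E] [FiniteDimensional ℝ E]
  {A : Type*} [TopologicalSpace A] {I : ModelWithCorners ℝ E A}
  {M : Type*} [TopologicalSpace M] [ChartedSpace A M] [IsManifold I ∞ M]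
  [T2Space M] [CompactSpace M]
  [RiemannianBundle (fun x : M ↦ TangentSpace I x)]
  {Ω : SymplecticForm I M} {H : M → ℝ} {X : (x : M) → TangentSpace I x} {φ : ℝ → M → M}

/-- Moving an identity into the total space lets fibre norms and inner products be compared over
equal base points. -/
theorem mk_eq_mk_of_eq {x y : M} (h : x = y) {v : TangentSpace I x} {w : TangentSpace I y}
    (hvw : (v : E) = w) : (⟨x, v⟩ : TangentBundle I M) = ⟨y, w⟩ := by
  subst h
  exact congrArg _ hvw

/-- The `X`-coordinate of the tangent flow with respect to the decomposition `N ⊕ ℝ X`. -/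
def fieldCoord (X : (x : M) → TangentSpace I x) (φ : ℝ → M → M) (t : ℝ) (x : M)
    (v : TangentSpace I x) : ℝ :=
  inner ℝ (X (φ t x)) (tangentFlow I φ t x v) / ‖X (φ t x)‖ ^ 2

theorem transversalPoincareFlow_apply (t : ℝ) (x : M) (v : TangentSpace I x) :
    transversalPoincareFlow X φ t x v =
      tangentFlow I φ t x v - fieldCoord X φ t x v • X (φ t x) := by
  unfold transversalPoincareFlow fieldCoord
  rw [ContinuousLinearMap.comp_apply, Submodule.starProjection_orthogonal_val,
    Submodule.starProjection_singleton]
  rfl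

theorem inner_transversalPoincareFlow (t : ℝ) (x : M) (v : TangentSpace I x) :
    inner ℝ (X (φ t x)) (transversalPoincareFlow X φ t x v) = 0 := by
  have := Submodule.starProjection_apply_mem ((Submodule.span ℝ {X (φ t x)})ᗮ)
    (tangentFlow I φ t x v)
  rw [Submodule.mem_orthogonal_singleton_iff_inner_right] at this
  exact this

theorem mem_transversalFibre {x : M} {v : TangentSpace I x} :
    v ∈ transversalFibre H X x ↔ inner ℝ (X x) v = 0 ∧ differential I H x v = 0 := by
  unfold transversalFibre
  rw [Submodule.mem_inf, Submodule.mem_orthogonal_singleton_iff_inner_right]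
  rfl

namespace IsHamiltonianFlow

theorem mk_tangentFlow_add (h : IsHamiltonianFlow Ω H X φ) (s t : ℝ) (x : M)
    (v : TangentSpace I x) :
    (⟨φ (s + t) x, tangentFlow I φ (s + t) x v⟩ : TangentBundle I M) =
      ⟨φ s (φ t x), tangentFlow I φ s (φ t x) (tangentFlow I φ t x v)⟩ :=
  mk_eq_mk_of_eq (h.add_apply s t x) (h.tangentFlow_add s t x v)

theorem norm_tangentFlow_add (h : IsHamiltonianFlow Ω H X φ) (s t : ℝ) (x : M)
    (v : TangentSpace I x) : ‖tangentFlow I φ (s + t) x v‖ =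
      ‖tangentFlow I φ s (φ t x) (tangentFlow I φ t x v)‖ :=
  congrArg (fun p : TangentBundle I M ↦ ‖p.2‖) (h.mk_tangentFlow_add s t x v)

theorem norm_tangentFlow_zero (h : IsHamiltonianFlow Ω H X φ) (x : M) (v : TangentSpace I x) :
    ‖tangentFlow I φ 0 x v‖ = ‖v‖ :=
  congrArg (fun p : TangentBundle I M ↦ ‖p.2‖)
    (mk_eq_mk_of_eq (h.zero_apply x) (h.tangentFlow_zero x v))

/-- Split `Dφᵗ v` into its transversal part and its `X`-part. The latter is carried along unchanged
because `Dφˢ X = X`, so the coordinate grows only by what the transversal part contributes. -/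
theorem fieldCoord_add (h : IsHamiltonianFlow Ω H X φ) (s t : ℝ) (x : M) (v : TangentSpace I x)
    (hX : X (φ s (φ t x)) ≠ 0) :
    fieldCoord X φ (s + t) x v = fieldCoord X φ t x v +
      fieldCoord X φ s (φ t x) (transversalPoincareFlow X φ t x v) := by
  have h1 : fieldCoord X φ (s + t) x v =
      fieldCoord X φ s (φ t x) (tangentFlow I φ t x v) :=
    congrArg (fun p : TangentBundle I M ↦ inner ℝ (X p.1) p.2 / ‖X p.1‖ ^ 2)
      (h.mk_tangentFlow_add s t x v)
  have h2 : tangentFlow I φ t x v = fieldCoord X φ t x v • X (φ t x) +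
      transversalPoincareFlow X φ t x v := by
    rw [transversalPoincareFlow_apply]; abel
  rw [h1]
  conv_lhs => rw [h2]
  unfold fieldCoord
  rw [map_add, map_smul, h.tangentFlow_field, inner_add_right, inner_smul_right,
    real_inner_self_eq_norm_sq, add_div, mul_div_assoc, div_self, mul_one]
  exact pow_ne_zero 2 (norm_ne_zero_iff.2 hX)

/-- The projection discards a multiple of `X`, which the next step maps to a multiple of `X` and
projects to zero. -/
theorem norm_transversalPoincareFlow_add (h : IsHamiltonianFlow Ω H X φ) (s t : ℝ) (x : M)
    (v : TangentSpace I x) (hX : X (φ s (φ t x)) ≠ 0) :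
    ‖transversalPoincareFlow X φ (s + t) x v‖ =
      ‖transversalPoincareFlow X φ s (φ t x) (transversalPoincareFlow X φ t x v)‖ := by
  have h1 : ‖transversalPoincareFlow X φ (s + t) x v‖ =
      ‖transversalPoincareFlow X φ s (φ t x) (tangentFlow I φ t x v)‖ := by
    rw [transversalPoincareFlow_apply, transversalPoincareFlow_apply]
    exact congrArg (fun p : TangentBundle I M ↦
      ‖p.2 - (inner ℝ (X p.1) p.2 / ‖X p.1‖ ^ 2) • X p.1‖) (h.mk_tangentFlow_add s t x v)
  have h2 : transversalPoincareFlow X φ s (φ t x) (X (φ t x)) = 0 := by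
    rw [transversalPoincareFlow_apply]
    unfold fieldCoord
    rw [h.tangentFlow_field, real_inner_self_eq_norm_sq, div_self, one_smul, sub_self]
    exact pow_ne_zero 2 (norm_ne_zero_iff.2 hX)
  rw [h1]
  congr 1
  conv_rhs => rw [transversalPoincareFlow_apply (t := t)]
  rw [map_sub, map_smul, h2, smul_zero, sub_zero]

theorem form_field_right (h : IsHamiltonianFlow Ω H X φ) (x : M) (v : TangentSpace I x) :
    Ω.form x v (X x) = -differential I H x v := by
  have h1 := Ω.alternating x (v + X x)
  simp only [map_add, _root_.add_apply, Ω.alternating, h.form_eq] at h1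
  linarith

/-- `Dφᵗ` preserves `Ω`, and the correction by multiples of `X` is invisible to `Ω` on vectors in
`ker dH`. This is the area preservation behind the whole argument. -/
theorem form_transversalPoincareFlow (h : IsHamiltonianFlow Ω H X φ) (t : ℝ) {x : M}
    {v w : TangentSpace I x} (hv : differential I H x v = 0) (hw : differential I H x w = 0) :
    Ω.form (φ t x) (transversalPoincareFlow X φ t x v) (transversalPoincareFlow X φ t x w) =
      Ω.form x v w := by
  rw [transversalPoincareFlow_apply, transversalPoincareFlow_apply, ← h.form_tangentFlow t x v w]
  simp only [map_sub, map_smul, sub_apply, smul_apply,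
    Ω.alternating, h.form_eq, h.form_field_right, h.differential_tangentFlow, hv, hw]
  simp

theorem transversalPoincareFlow_ne_zero (h : IsHamiltonianFlow Ω H X φ) (t : ℝ) {x : M}
    {v : TangentSpace I x} (hv : v ≠ 0) (hvX : inner ℝ (X x) v = 0) :
    transversalPoincareFlow X φ t x v ≠ 0 := by
  intro h0
  rw [transversalPoincareFlow_apply, sub_eq_zero, ← h.tangentFlow_field, ← map_smul] at h0
  have h1 := h.tangentFlow_injective t x h0
  rw [h1, inner_smul_right, real_inner_self_eq_norm_sq, mul_eq_zero] at hvX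
  refine hv ?_
  rw [h1]
  rcases hvX with h2 | h2
  · rw [h2, zero_smul]
  · rw [norm_eq_zero.1 (pow_eq_zero_iff two_ne_zero |>.1 h2), smul_zero]

/-- The left side contains no division by `‖X‖`, so it is continuous on all of `M`, also where `X`
vanishes. -/
theorem norm_sq_transversalPoincareFlow (t : ℝ) (x : M) (v : TangentSpace I x)
    (hX : X (φ t x) ≠ 0) :
    ‖X (φ t x)‖ * ‖X (φ t x)‖ * (‖tangentFlow I φ t x v‖ * ‖tangentFlow I φ t x v‖) -
      inner ℝ (X (φ t x)) (tangentFlow I φ t x v) * inner ℝ (X (φ t x)) (tangentFlow I φ t x v) =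
      (‖X (φ t x)‖ * ‖transversalPoincareFlow X φ t x v‖) ^ 2 := by
  have h0 := norm_ne_zero_iff.2 hX
  rw [mul_pow, transversalPoincareFlow_apply, norm_sub_sq_real, inner_smul_right, norm_smul,
    real_inner_comm (X (φ t x)) (tangentFlow I φ t x v), mul_pow, Real.norm_eq_abs, sq_abs]
  unfold fieldCoord
  field_simp
  ring

end IsHamiltonianFlow

end Transversal

/-! ### Uniform bounds over compact sets -/

section Bounds

set_option linter.unusedSectionVars false

open Set Filter

variable {E : Type*} [NormedAddCommGroup E] [NormedSpace ℝ E] [FiniteDimensional ℝ E]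
  {A : Type*} [TopologicalSpace A] {I : ModelWithCorners ℝ E A}
  {M : Type*} [TopologicalSpace M] [ChartedSpace A M] [IsManifold I ∞ M]
  [T2Space M] [CompactSpace M]
  [RiemannianBundle (fun x : M ↦ TangentSpace I x)]
  [IsContinuousRiemannianBundle E (fun x : M ↦ TangentSpace I x)]
  {Ω : SymplecticForm I M} {H : M → ℝ} {X : (x : M) → TangentSpace I x} {φ : ℝ → M → M}

theorem bihomogeneous_norm_mul_norm :
    Bihomogeneous fun (x : M) (v w : TangentSpace I x) ↦ ‖v‖ * ‖w‖ := fun x v w a b ↦ by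
  beta_reduce
  rw [norm_smul, norm_smul, Real.norm_eq_abs, Real.norm_eq_abs]; ring

theorem fibreContinuous_norm_mul_norm :
    FibreContinuous fun (x : M) (v w : TangentSpace I x) ↦ ‖v‖ * ‖w‖ :=
  fibreContinuousVec_fst.norm.mul fibreContinuousVec_snd.norm

theorem SymplecticForm.exists_bound (Ω : SymplecticForm I M) :
    ∃ C > 0, ∀ (x : M) (v w : TangentSpace I x), |Ω.form x v w| ≤ C * (‖v‖ * ‖w‖) := by
  obtain ⟨C, hC, h⟩ := exists_bound_of_bihomogeneous (I := I) (isClosed_univ (X := M))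
    (fibreContinuousVec_fst.form fibreContinuousVec_snd Ω).abs fibreContinuous_norm_mul_norm
    (fun x v w a b ↦ by
      simp only [map_smul, _root_.smul_apply, smul_eq_mul, abs_mul]; ring)
    bihomogeneous_norm_mul_norm
    (fun x _ v w hv hw ↦ mul_pos (norm_pos_iff.2 hv) (norm_pos_iff.2 hw))
  exact ⟨C, hC, fun x ↦ h x (mem_univ x)⟩

namespace IsHamiltonianFlow

theorem field_ne_zero (h : IsHamiltonianFlow Ω H X φ) {x : M} (hx : differential I H x ≠ 0) :
    X x ≠ 0 := by
  intro h0
  refine hx (ContinuousLinearMap.ext fun v ↦ ?_)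
  rw [← h.form_eq, h0, map_zero]

theorem continuous_flow (h : IsHamiltonianFlow Ω H X φ) (t : ℝ) : Continuous (φ t) :=
  (h.contMDiff_flow t).continuous

/-- The comparison lemma is about two vectors; the factor `‖w‖` is inserted for this purpose and
removed by taking `w = v`. -/
theorem exists_norm_tangentFlow_le (h : IsHamiltonianFlow Ω H X φ) (t : ℝ) :
    ∃ C > 0, ∀ (x : M) (v : TangentSpace I x), ‖tangentFlow I φ t x v‖ ≤ C * ‖v‖ := by
  obtain ⟨C, hC, hb⟩ := exists_bound_of_bihomogeneous (I := I) (isClosed_univ (X := M))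
    (F := fun x v w ↦ ‖tangentFlow I φ t x v‖ * ‖w‖)
    ((fibreContinuousVec_fst.map (h.continuous_tangentFlow t)).norm.mul
      fibreContinuousVec_snd.norm)
    fibreContinuous_norm_mul_norm
    (fun x v w a b ↦ by
      beta_reduce
      rw [map_smul, norm_smul, norm_smul, Real.norm_eq_abs, Real.norm_eq_abs]; ring)
    bihomogeneous_norm_mul_norm
    (fun x _ v w hv hw ↦ mul_pos (norm_pos_iff.2 hv) (norm_pos_iff.2 hw))
  refine ⟨C, hC, fun x v ↦ ?_⟩
  by_cases hv : v = 0
  · simp [hv]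
  · refine le_of_mul_le_mul_right ?_ (norm_pos_iff.2 hv)
    calc _ ≤ _ := hb x (mem_univ x) v v
      _ = _ := by ring

/-- Compare `‖X‖ ‖v‖ ‖w‖` with `‖v‖ ‖w‖` in both directions and evaluate at `v = w = X`, which is
nonzero on `K`. -/
theorem exists_norm_field_bounds (h : IsHamiltonianFlow Ω H X φ) {K : Set M} (hK : IsClosed K)
    (hKH : ∀ x ∈ K, differential I H x ≠ 0) :
    ∃ C > 0, ∀ x ∈ K, ‖X x‖ ≤ C ∧ 1 ≤ C * ‖X x‖ := by
  have hX : FibreContinuous fun (x : M) (v w : TangentSpace I x) ↦ ‖X x‖ * (‖v‖ * ‖w‖) :=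
    (fibreContinuousVec_field (continuous_hamiltonianField h.contMDiff h.form_eq)
      continuous_id).norm.mul fibreContinuous_norm_mul_norm
  have hXh : Bihomogeneous fun (x : M) (v w : TangentSpace I x) ↦ ‖X x‖ * (‖v‖ * ‖w‖) :=
    fun x v w a b ↦ by
      have h1 := bihomogeneous_norm_mul_norm x v w a b
      beta_reduce at h1 ⊢
      rw [h1]; ring
  obtain ⟨C₁, hC₁, h₁⟩ := exists_bound_of_bihomogeneous hK hX fibreContinuous_norm_mul_norm hXh
    bihomogeneous_norm_mul_norm
    (fun x _ v w hv hw ↦ mul_pos (norm_pos_iff.2 hv) (norm_pos_iff.2 hw))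
  obtain ⟨C₂, hC₂, h₂⟩ := exists_bound_of_bihomogeneous hK fibreContinuous_norm_mul_norm hX
    bihomogeneous_norm_mul_norm hXh
    (fun x hx v w hv hw ↦ mul_pos (norm_pos_iff.2 (h.field_ne_zero (hKH x hx)))
      (mul_pos (norm_pos_iff.2 hv) (norm_pos_iff.2 hw)))
  refine ⟨max C₁ C₂, lt_max_of_lt_left hC₁, fun x hx ↦ ?_⟩
  have h0 : 0 < ‖X x‖ := norm_pos_iff.2 (h.field_ne_zero (hKH x hx))
  have h1 := h₁ x hx (X x) (X x)
  have h2 := h₂ x hx (X x) (X x)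
  constructor
  · exact (le_of_mul_le_mul_right h1 (mul_pos h0 h0)).trans (le_max_left _ _)
  · rw [← mul_assoc] at h2
    have h3 : 1 * (‖X x‖ * ‖X x‖) ≤ C₂ * ‖X x‖ * (‖X x‖ * ‖X x‖) := by rwa [one_mul]
    exact (le_of_mul_le_mul_right h3 (mul_pos h0 h0)).trans
      (mul_le_mul_of_nonneg_right (le_max_right _ _) h0.le)

/-- Domination excludes that `v` and `w` are parallel, so `v`, `w`, `X` span `ker dH`. If `Ω(v, w) =
0`, then `Ω(v, ·)` vanishes on `ker dH`, hence is a multiple of `dH = Ω(X, ·)`. By nondegeneracy `v`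
would be a multiple of `X`, contrary to `v ⊥ X`. -/
theorem form_ne_zero_of_dominated (hE : Module.finrank ℝ E = 4) (h : IsHamiltonianFlow Ω H X φ)
    {x : M} (hx : differential I H x ≠ 0) {t : ℝ} {v w : TangentSpace I x} (hv : v ≠ 0)
    (hw : w ≠ 0) (hv' : v ∈ transversalFibre H X x) (hw' : w ∈ transversalFibre H X x)
    (hdom : 2 * ‖transversalPoincareFlow X φ t x v‖ * ‖w‖ ≤
      ‖transversalPoincareFlow X φ t x w‖ * ‖v‖) : Ω.form x v w ≠ 0 := by
  intro hΩ
  obtain ⟨hvX, hvH⟩ := mem_transversalFibre.1 hv'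
  obtain ⟨hwX, hwH⟩ := mem_transversalFibre.1 hw'
  have hX := h.field_ne_zero hx
  have hpar : ∀ c : ℝ, w ≠ c • v := by
    rintro c rfl
    have hc : 0 < |c| := abs_pos.2 fun hc ↦ hw (by rw [hc, zero_smul])
    rw [map_smul, norm_smul, norm_smul, Real.norm_eq_abs] at hdom
    have h1 : 0 < |c| * ‖transversalPoincareFlow X φ t x v‖ * ‖v‖ :=
      mul_pos (mul_pos hc (norm_pos_iff.2 (h.transversalPoincareFlow_ne_zero t hv hvX)))
        (norm_pos_iff.2 hv)
    linarith
  have hind : ∀ a b c : ℝ, a • v + b • w + c • X x = 0 → a = 0 ∧ b = 0 ∧ c = 0 := by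
    intro a b c habc
    have hc : c = 0 := by
      have h1 := congrArg (inner ℝ (X x)) habc
      rw [inner_add_right, inner_add_right, inner_smul_right, inner_smul_right, inner_smul_right,
        hvX, hwX, inner_zero_right, real_inner_self_eq_norm_sq] at h1
      simpa [hX] using h1
    rw [hc, zero_smul, add_zero] at habc
    have hb : b = 0 := by
      by_contra hb
      refine hpar (-(b⁻¹ * a)) ?_
      have h1 : b⁻¹ • (a • v + b • w) = 0 := by rw [habc, smul_zero]
      rw [smul_add, smul_smul, smul_smul, inv_mul_cancel₀ hb, one_smul] at h1
      rw [neg_smul]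
      exact eq_neg_of_add_eq_zero_right h1
    rw [hb, zero_smul, add_zero, smul_eq_zero] at habc
    exact ⟨habc.resolve_right hv, hb, hc⟩
  have hl : (differential I H x).toLinearMap ≠ 0 := fun h0 ↦
    hx (ContinuousLinearMap.ext fun v ↦ LinearMap.congr_fun h0 v)
  have hker : ∀ z, differential I H x z = 0 → Ω.form x v z = 0 := by
    intro z hz
    obtain ⟨a, b, c, rfl⟩ := exists_eq_of_mem_ker (V := TangentSpace I x) hE hl hvH hwH
      (h.differential_field x) hind hz
    rw [map_add, map_add, map_smul, map_smul, map_smul, Ω.alternating, hΩ, h.form_field_right,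
      hvH]
    simp
  obtain ⟨z₀, hz₀⟩ : ∃ z, differential I H x z ≠ 0 := by
    by_contra! h0
    exact hx (ContinuousLinearMap.ext h0)
  set c := Ω.form x v z₀ / differential I H x z₀ with hc
  have hvc : v - c • X x = 0 := by
    refine Ω.nondegenerate x _ fun z ↦ ?_
    have h1 := hker (z - (differential I H x z / differential I H x z₀) • z₀) (by
      rw [map_sub, map_smul, smul_eq_mul, div_mul_cancel₀ _ hz₀, sub_self])
    rw [map_sub, map_smul, smul_eq_mul] at h1
    rw [map_sub, map_smul, _root_.sub_apply, _root_.smul_apply, h.form_eq, smul_eq_mul, hc,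
      ← h1]
    field_simp
  rw [sub_eq_zero] at hvc
  rw [hvc, inner_smul_right, real_inner_self_eq_norm_sq, mul_eq_zero] at hvX
  rcases hvX with h1 | h1
  · exact hv (by rw [hvc, h1, zero_smul])
  · exact hX (norm_eq_zero.1 (pow_eq_zero_iff two_ne_zero |>.1 h1))

/-- Over a compact invariant set of regular points, the area spanned by two transversal vectors, the
first of which is dominated by the second, is comparable to the product of their norms. -/
theorem exists_norm_mul_norm_le_form (hE : Module.finrank ℝ E = 4)
    (h : IsHamiltonianFlow Ω H X φ) {K : Set M} (hK : IsClosed K) (hKφ : IsInvariantSet φ K)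
    (hKH : ∀ x ∈ K, differential I H x ≠ 0) (t : ℝ) :
    ∃ C > 0, ∀ x ∈ K, ∀ v ∈ transversalFibre H X x, ∀ w ∈ transversalFibre H X x,
      2 * ‖transversalPoincareFlow X φ t x v‖ * ‖w‖ ≤
        ‖transversalPoincareFlow X φ t x w‖ * ‖v‖ → ‖v‖ * ‖w‖ ≤ C * |Ω.form x v w| := by
  have hXc := continuous_hamiltonianField h.contMDiff h.form_eq
  have hX₀ := fibreContinuousVec_field hXc (continuous_id (X := M))
  have hX₁ := fibreContinuousVec_field hXc (h.continuous_flow t)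
  have hfst := fibreContinuousVec_fst (I := I) (M := M)
  have hsnd := fibreContinuousVec_snd (I := I) (M := M)
  -- On `K` this is `‖X‖ ‖Φᵗ v‖`, a substitute for `‖Φᵗ v‖` that is continuous everywhere.
  let q (x : M) (v : TangentSpace I x) : ℝ :=
    √(‖X (φ t x)‖ * ‖X (φ t x)‖ * (‖tangentFlow I φ t x v‖ * ‖tangentFlow I φ t x v‖) -
      inner ℝ (X (φ t x)) (tangentFlow I φ t x v) * inner ℝ (X (φ t x)) (tangentFlow I φ t x v))
  have hq : ∀ x ∈ K, ∀ v, q x v = ‖X (φ t x)‖ * ‖transversalPoincareFlow X φ t x v‖ := by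
    intro x hx v
    change √_ = _
    rw [norm_sq_transversalPoincareFlow t x v (h.field_ne_zero (hKH _ (hKφ t x hx))),
      Real.sqrt_sq (by positivity)]
  have hqh : ∀ x (v : TangentSpace I x) (a : ℝ), q x (a • v) = |a| * q x v := by
    intro x v a
    change √_ = |a| * √_
    rw [← Real.sqrt_sq_eq_abs, ← Real.sqrt_mul (sq_nonneg a)]
    congr 1
    rw [map_smul, norm_smul, inner_smul_right, Real.norm_eq_abs]
    linear_combination (‖X (φ t x)‖ * ‖X (φ t x)‖ * (‖tangentFlow I φ t x v‖ *
      ‖tangentFlow I φ t x v‖)) * abs_mul_abs_self a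
  have hqc : ∀ {V : (x : M) → TangentSpace I x → TangentSpace I x → TangentSpace I x},
      FibreContinuousVec id V → FibreContinuous fun x v w ↦ q x (V x v w) := fun hV ↦
    (((hX₁.norm.mul hX₁.norm).mul ((hV.map (h.continuous_tangentFlow t)).norm.mul
      (hV.map (h.continuous_tangentFlow t)).norm)).sub
      ((hX₁.inner (hV.map (h.continuous_tangentFlow t))).mul
      (hX₁.inner (hV.map (h.continuous_tangentFlow t))))).sqrt
  -- Over `K`, for nonzero `v` and `w`, `Z` vanishes only if both are transversal, `v` is dominated
  -- by `w`, and `Ω(v, w) = 0`. That is impossible, so `Z > 0`. On transversal dominated pairs only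
  -- the first term survives.
  let Z (x : M) (v w : TangentSpace I x) : ℝ := |Ω.form x v w| +
    (|Ω.form x (X x) v| * ‖w‖ + |Ω.form x (X x) w| * ‖v‖) +
    (|inner ℝ (X x) v| * ‖w‖ + |inner ℝ (X x) w| * ‖v‖) +
    max 0 (2 * (q x v * ‖w‖) - q x w * ‖v‖)
  have hZc : FibreContinuous Z :=
    (((hfst.form hsnd Ω).abs.add
      (((hX₀.form hfst Ω).abs.mul hsnd.norm).add ((hX₀.form hsnd Ω).abs.mul hfst.norm))).add
      (((hX₀.inner hfst).abs.mul hsnd.norm).add ((hX₀.inner hsnd).abs.mul hfst.norm))).add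
      ((((hqc hfst).mul hsnd.norm).const_mul 2).sub ((hqc hsnd).mul hfst.norm)).posPart
  have hZh : Bihomogeneous Z := by
    intro x v w a b
    have h1 : 2 * (q x (a • v) * ‖b • w‖) - q x (b • w) * ‖a • v‖ =
        |a| * |b| * (2 * (q x v * ‖w‖) - q x w * ‖v‖) := by
      rw [hqh, hqh, norm_smul, norm_smul, Real.norm_eq_abs, Real.norm_eq_abs]; ring
    change |_| + (|_| * _ + |_| * _) + (|_| * _ + |_| * _) + max 0 _ = |a| * |b| * (_ + max 0 _)
    rw [h1]
    simp only [map_smul, _root_.smul_apply, smul_eq_mul, abs_mul, inner_smul_right, norm_smul,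
      Real.norm_eq_abs]
    rw [← mul_zero (|a| * |b|), ← mul_max_of_nonneg _ _ (by positivity), mul_zero]
    ring
  have hZpos : ∀ x ∈ K, ∀ v w : TangentSpace I x, v ≠ 0 → w ≠ 0 → 0 < Z x v w := by
    intro x hx v w hv hw
    by_contra! hle
    have hv0 := norm_pos_iff.2 hv
    have hw0 := norm_pos_iff.2 hw
    have hX0 := norm_pos_iff.2 (h.field_ne_zero (hKH _ (hKφ t x hx)))
    have e1 : 0 ≤ |Ω.form x v w| := abs_nonneg _
    have e2 : 0 ≤ |Ω.form x (X x) v| * ‖w‖ := by positivity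
    have e3 : 0 ≤ |Ω.form x (X x) w| * ‖v‖ := by positivity
    have e4 : 0 ≤ |inner ℝ (X x) v| * ‖w‖ := by positivity
    have e5 : 0 ≤ |inner ℝ (X x) w| * ‖v‖ := by positivity
    have e6 : 0 ≤ max 0 (2 * (q x v * ‖w‖) - q x w * ‖v‖) := le_max_left _ _
    change _ + (_ + _) + (_ + _) + _ ≤ 0 at hle
    have f1 : Ω.form x v w = 0 := abs_nonpos_iff.1 (by linarith)
    have f2 : Ω.form x (X x) v = 0 :=
      abs_nonpos_iff.1 (nonpos_of_mul_nonpos_left (by linarith) hw0)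
    have f3 : Ω.form x (X x) w = 0 :=
      abs_nonpos_iff.1 (nonpos_of_mul_nonpos_left (by linarith) hv0)
    have f4 : inner ℝ (X x) v = 0 :=
      abs_nonpos_iff.1 (nonpos_of_mul_nonpos_left (by linarith) hw0)
    have f5 : inner ℝ (X x) w = 0 :=
      abs_nonpos_iff.1 (nonpos_of_mul_nonpos_left (by linarith) hv0)
    have f6 : 2 * (q x v * ‖w‖) - q x w * ‖v‖ ≤ 0 := (le_max_right _ _).trans (by linarith)
    rw [h.form_eq] at f2 f3
    refine h.form_ne_zero_of_dominated hE (hKH x hx) (t := t) hv hw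
      (mem_transversalFibre.2 ⟨f4, f2⟩) (mem_transversalFibre.2 ⟨f5, f3⟩) ?_ f1
    rw [hq x hx, hq x hx] at f6
    refine le_of_mul_le_mul_left ?_ hX0
    linarith
  obtain ⟨C, hC, hb⟩ := exists_bound_of_bihomogeneous hK fibreContinuous_norm_mul_norm hZc
    bihomogeneous_norm_mul_norm hZh hZpos
  refine ⟨C, hC, fun x hx v hv w hw hdom ↦ (hb x hx v w).trans (le_of_eq ?_)⟩
  obtain ⟨hvX, hvH⟩ := mem_transversalFibre.1 hv
  obtain ⟨hwX, hwH⟩ := mem_transversalFibre.1 hw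
  have h1 : max 0 (2 * (q x v * ‖w‖) - q x w * ‖v‖) = 0 := by
    refine max_eq_left ?_
    rw [hq x hx, hq x hx]
    have h2 := mul_le_mul_of_nonneg_left hdom (norm_nonneg (X (φ t x)))
    linarith
  change C * (_ + (_ + _) + (_ + _) + _) = _
  rw [h1, h.form_eq, h.form_eq, hvX, hwX, hvH, hwH]
  simp

end IsHamiltonianFlow

end Bounds

/-! ### From domination to contracted tangent vectors -/

section Contraction

set_option linter.unusedSectionVars false

open Set Filter

variable {E : Type*} [NormedAddCommGroup E] [NormedSpace ℝ E] [FiniteDimensional ℝ E]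
  {A : Type*} [TopologicalSpace A] {I : ModelWithCorners ℝ E A}
  {M : Type*} [TopologicalSpace M] [ChartedSpace A M] [IsManifold I ∞ M]
  [T2Space M] [CompactSpace M]
  [RiemannianBundle (fun x : M ↦ TangentSpace I x)]
  [IsContinuousRiemannianBundle E (fun x : M ↦ TangentSpace I x)]
  {Ω : SymplecticForm I M} {H : M → ℝ} {X : (x : M) → TangentSpace I x} {φ : ℝ → M → M}

/-- The tangent vector `v` is contracted, at all integer multiples of the time `τ`, at an exponential
rate with constant `B` and ratio `l`. -/
def IsContracted (φ : ℝ → M → M) (τ B l : ℝ) (x : M) (v : TangentSpace I x) : Prop :=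
  ∀ (j : ℤ) (k : ℕ), ‖tangentFlow I φ ((j + k : ℤ) * τ) x v‖ ≤
    B * l ^ k * ‖tangentFlow I φ (j * τ) x v‖

theorem sqrt_half_lt_one : √(1 / 2 : ℝ) < 1 := by
  rw [Real.sqrt_lt' one_pos]; norm_num

namespace IsDominatedSplitting

variable {Λ : Set M} {m : ℕ} {Nm Np : (x : M) → Submodule ℝ (TangentSpace I x)}

theorem two_mul_le (hD : IsDominatedSplitting H X φ Λ m Nm Np) {x : M} (hx : x ∈ Λ)
    {u w : TangentSpace I x} (hu : u ∈ Nm x) (hw : w ∈ Np x) (hu0 : u ≠ 0) (hw0 : w ≠ 0)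
    (hΦw : transversalPoincareFlow X φ m x w ≠ 0) :
    2 * ‖transversalPoincareFlow X φ m x u‖ * ‖w‖ ≤
      ‖transversalPoincareFlow X φ m x w‖ * ‖u‖ := by
  have hu0' := norm_pos_iff.2 hu0
  have hw0' := norm_pos_iff.2 hw0
  have h1 : ‖transversalPoincareFlow X φ m x u‖ ≤
      normOn (transversalPoincareFlow X φ m x) (Nm x) * ‖u‖ :=
    (transversalPoincareFlow X φ m x ∘L (Nm x).subtypeL).le_opNorm ⟨u, hu⟩
  have h2 : ‖transversalPoincareFlow X φ m x w‖ ≤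
      normOn (transversalPoincareFlow X φ m x) (Np x) * ‖w‖ :=
    (transversalPoincareFlow X φ m x ∘L (Np x).subtypeL).le_opNorm ⟨w, hw⟩
  have h3 : normOn (transversalPoincareFlow X φ m x) (Np x) ≤
      ‖transversalPoincareFlow X φ m x w‖ / ‖w‖ := by
    refine ContinuousLinearMap.opNorm_le_bound _ (by positivity) ?_
    rintro ⟨z, hz⟩
    obtain ⟨c, hc⟩ := exists_smul_eq_of_finrank_eq_one (hD.finrank_plus x hx)
      (x := (⟨w, hw⟩ : Np x)) (fun h ↦ hw0 (congrArg Subtype.val h)) ⟨z, hz⟩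
    have hc' : c • w = z := congrArg Subtype.val hc
    subst hc'
    change ‖transversalPoincareFlow X φ m x (c • w)‖ ≤ _ * ‖c • w‖
    rw [map_smul, norm_smul, norm_smul]
    refine le_of_eq ?_
    field_simp
  -- A vanishing denominator would make the quotient in the domination condition zero and the
  -- condition void.
  have h4 : 0 < normOn (transversalPoincareFlow X φ m x) (Np x) := by
    have h5 := norm_pos_iff.2 hΦw
    exact pos_of_mul_pos_left (h5.trans_le h2) hw0'.le
  have h5 := hD.dominated x hx
  rw [div_le_iff₀ h4] at h5
  rw [le_div_iff₀ hw0'] at h3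
  calc 2 * ‖transversalPoincareFlow X φ m x u‖ * ‖w‖
      ≤ 2 * (1 / 2 * normOn (transversalPoincareFlow X φ m x) (Np x) * ‖u‖) * ‖w‖ := by
        gcongr
        exact h1.trans (mul_le_mul_of_nonneg_right h5 hu0'.le)
    _ = normOn (transversalPoincareFlow X φ m x) (Np x) * ‖w‖ * ‖u‖ := by ring
    _ ≤ _ := by gcongr

/-- A dominated splitting of the transversal linear Poincaré flow of a Hamiltonian flow is
uniformly contracted in the past and in the future. -/
theorem exists_decay (hE : Module.finrank ℝ E = 4) (h : IsHamiltonianFlow Ω H X φ)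
    (hD : IsDominatedSplitting H X φ Λ m Nm Np) (hKφ : IsInvariantSet φ (closure Λ))
    (hKH : ∀ x ∈ closure Λ, differential I H x ≠ 0) :
    ∃ B, ∀ x ∈ Λ,
      (∃ u ∈ transversalFibre H X x, u ≠ 0 ∧ ∀ (j : ℤ) (k : ℕ),
        ‖transversalPoincareFlow X φ ((j + k : ℤ) * (m : ℝ)) x u‖ ^ 2 ≤
          B * (1 / 2) ^ k * ‖transversalPoincareFlow X φ (j * (m : ℝ)) x u‖ ^ 2) ∧
      (∃ w ∈ transversalFibre H X x, w ≠ 0 ∧ ∀ (j : ℤ) (k : ℕ),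
        ‖transversalPoincareFlow X φ ((j + k : ℤ) * (-m : ℝ)) x w‖ ^ 2 ≤
          B * (1 / 2) ^ k * ‖transversalPoincareFlow X φ (j * (-m : ℝ)) x w‖ ^ 2) := by
  obtain ⟨C₁, hC₁, h₁⟩ := Ω.exists_bound
  obtain ⟨C₂, hC₂, h₂⟩ := h.exists_norm_mul_norm_le_form hE isClosed_closure hKφ hKH m
  refine ⟨C₂ * C₁, fun x hx ↦ ?_⟩
  have hΛK : ∀ t, φ t x ∈ Λ := fun t ↦ hD.invariant_set t x hx
  have hX : ∀ y ∈ Λ, X y ≠ 0 := fun y hy ↦ h.field_ne_zero (hKH y (subset_closure hy))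
  obtain ⟨⟨u, hu⟩, hu0, -⟩ := finrank_eq_one_iff'.1 (hD.finrank_minus x hx)
  obtain ⟨⟨w, hw⟩, hw0, -⟩ := finrank_eq_one_iff'.1 (hD.finrank_plus x hx)
  replace hu0 : u ≠ 0 := fun h ↦ hu0 (Subtype.ext h)
  replace hw0 : w ≠ 0 := fun h ↦ hw0 (Subtype.ext h)
  have hNm : ∀ y ∈ Λ, Nm y ≤ transversalFibre H X y := fun y hy ↦
    le_sup_left.trans (hD.sup_eq y hy).le
  have hNp : ∀ y ∈ Λ, Np y ≤ transversalFibre H X y := fun y hy ↦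
    le_sup_right.trans (hD.sup_eq y hy).le
  have hut : ∀ t, transversalPoincareFlow X φ t x u ∈ Nm (φ t x) := fun t ↦ by
    rw [← hD.invariant_minus x hx t]
    exact Submodule.mem_map_of_mem hu
  have hwt : ∀ t, transversalPoincareFlow X φ t x w ∈ Np (φ t x) := fun t ↦ by
    rw [← hD.invariant_plus x hx t]
    exact Submodule.mem_map_of_mem hw
  obtain ⟨huX, huH⟩ := mem_transversalFibre.1 (hNm x hx hu)
  obtain ⟨hwX, hwH⟩ := mem_transversalFibre.1 (hNp x hx hw)
  have hut0 : ∀ t, transversalPoincareFlow X φ t x u ≠ 0 := fun t ↦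
    h.transversalPoincareFlow_ne_zero t hu0 huX
  have hwt0 : ∀ t, transversalPoincareFlow X φ t x w ≠ 0 := fun t ↦
    h.transversalPoincareFlow_ne_zero t hw0 hwX
  have hstep : ∀ t, 2 * ‖transversalPoincareFlow X φ m (φ t x)
      (transversalPoincareFlow X φ t x u)‖ * ‖transversalPoincareFlow X φ t x w‖ ≤
      ‖transversalPoincareFlow X φ m (φ t x) (transversalPoincareFlow X φ t x w)‖ *
      ‖transversalPoincareFlow X φ t x u‖ := fun t ↦
    hD.two_mul_le (hΛK t) (hut t) (hwt t) (hut0 t) (hwt0 t)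
      (h.transversalPoincareFlow_ne_zero m (hwt0 t) (inner_transversalPoincareFlow t x w))
  have hdecay := sq_le_of_domination (B := C₂ * C₁)
    (a := fun j : ℤ ↦ ‖transversalPoincareFlow X φ (j * (m : ℝ)) x u‖)
    (b := fun j : ℤ ↦ ‖transversalPoincareFlow X φ (j * (m : ℝ)) x w‖)
    (fun j ↦ norm_pos_iff.2 (hut0 _)) (fun j ↦ norm_pos_iff.2 (hwt0 _))
    (fun i j ↦ by
      have e1 := h₂ _ (subset_closure (hΛK (i * (m : ℝ)))) _ (hNm _ (hΛK _) (hut _)) _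
        (hNp _ (hΛK _) (hwt _)) (hstep _)
      have e2 := h₁ _ (transversalPoincareFlow X φ (j * (m : ℝ)) x u)
        (transversalPoincareFlow X φ (j * (m : ℝ)) x w)
      rw [h.form_transversalPoincareFlow _ huH hwH] at e1 e2
      refine e1.trans ?_
      rw [mul_assoc]
      exact mul_le_mul_of_nonneg_left e2 hC₂.le)
    (fun j ↦ by
      have e1 := hstep (j * (m : ℝ))
      rw [← h.norm_transversalPoincareFlow_add _ _ _ _ (hX _ (hD.invariant_set _ _ (hΛK _))),
        ← h.norm_transversalPoincareFlow_add _ _ _ _ (hX _ (hD.invariant_set _ _ (hΛK _)))] at e1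
      have e2 : ((j + 1 : ℤ) : ℝ) * (m : ℝ) = m + j * m := by push_cast; ring
      rw [e2, ← mul_assoc]
      exact e1)
  refine ⟨⟨u, hNm x hx hu, hu0, fun j k ↦ (hdecay j k).1⟩,
    ⟨w, hNp x hx hw, hw0, fun j k ↦ ?_⟩⟩
  -- Growth of `w` in forward time, read backwards: step `j + k` of size `-m` is step `-j - k` of
  -- size `m`.
  have e1 := (hdecay (-j - k) k).2
  have e2 : ((-j - k : ℤ) : ℝ) * (m : ℝ) = (j + k : ℤ) * (-m : ℝ) := by push_cast; ring
  have e3 : ((-j - k + k : ℤ) : ℝ) * (m : ℝ) = j * (-m : ℝ) := by push_cast; ring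
  beta_reduce at e1
  rw [e2, e3] at e1
  exact e1

end IsDominatedSplitting

namespace IsHamiltonianFlow

/-- A transversal vector contracted by the transversal linear Poincaré flow has a lift contracted by
the tangent flow. -/
theorem exists_isContracted_of_decay (h : IsHamiltonianFlow Ω H X φ) {K : Set M}
    (hK : IsClosed K) (hKφ : IsInvariantSet φ K) (hKH : ∀ x ∈ K, differential I H x ≠ 0)
    (τ B : ℝ) :
    ∃ B' > 0, ∀ x ∈ K, ∀ u ∈ transversalFibre H X x, u ≠ 0 →
      (∀ (j : ℤ) (k : ℕ), ‖transversalPoincareFlow X φ ((j + k : ℤ) * τ) x u‖ ^ 2 ≤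
        B * (1 / 2) ^ k * ‖transversalPoincareFlow X φ (j * τ) x u‖ ^ 2) →
      ∃ v : TangentSpace I x, v ≠ 0 ∧ differential I H x v = 0 ∧
        IsContracted φ τ B' (√(1 / 2)) x v := by
  obtain ⟨C₁, hC₁, h₁⟩ := h.exists_norm_tangentFlow_le τ
  obtain ⟨C₂, hC₂, h₂⟩ := h.exists_norm_field_bounds hK hKH
  set l := √(1 / 2 : ℝ) with hl
  have hl1 : l < 1 := sqrt_half_lt_one
  have hl0 : 0 ≤ l := Real.sqrt_nonneg _
  -- This makes `b` positive with `B ≤ b ^ 2` whatever the sign of `B`. The ratio becomes `√(1/2)`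
  -- because the decay is given for squares.
  set b := √B + 1 with hb
  have hb0 : 0 < b := by positivity
  have hl1' : 0 < 1 - l := by linarith
  set C₃ := C₁ * C₂ * b / (1 - l) with hC₃
  have hC₃0 : 0 ≤ C₃ := by positivity
  refine ⟨(1 + C₃ * C₂) * b, by positivity, fun x hx u hu hu0 hdec ↦ ?_⟩
  obtain ⟨huX, huH⟩ := mem_transversalFibre.1 hu
  set a : ℤ → ℝ := fun j ↦ ‖transversalPoincareFlow X φ (j * τ) x u‖ with ha
  set α : ℤ → ℝ := fun j ↦ fieldCoord X φ (j * τ) x u with hα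
  have ha0 : ∀ j, 0 ≤ a j := fun j ↦ norm_nonneg _
  have hdecay : ∀ (j : ℤ) (k : ℕ), a (j + k) ≤ b * l ^ k * a j := by
    intro j k
    refine le_of_sq_le_sq ?_ (by have := ha0 j; positivity)
    have hBb : B ≤ b ^ 2 := by
      rcases le_total 0 B with hB | hB
      · have e1 := Real.sq_sqrt hB
        have e2 := Real.sqrt_nonneg B
        rw [hb]; nlinarith
      · exact hB.trans (sq_nonneg b)
    have hlk : (l ^ k) ^ 2 = (1 / 2) ^ k := by
      rw [← pow_mul, mul_comm, pow_mul, hl, Real.sq_sqrt (by norm_num)]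
    calc a (j + k) ^ 2 ≤ B * (1 / 2) ^ k * a j ^ 2 := hdec j k
      _ ≤ b ^ 2 * (1 / 2) ^ k * a j ^ 2 := by gcongr
      _ = _ := by rw [mul_pow, mul_pow, hlk]
  have hXne : ∀ y ∈ K, X y ≠ 0 := fun y hy ↦ h.field_ne_zero (hKH y hy)
  have hinc : ∀ j, |α (j + 1) - α j| ≤ C₁ * C₂ * a j := by
    intro j
    have e1 : ((j + 1 : ℤ) : ℝ) * τ = τ + j * τ := by push_cast; ring
    have hy : φ τ (φ (j * τ) x) ∈ K := hKφ _ _ (hKφ _ _ hx)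
    have e2 : α (j + 1) - α j =
        fieldCoord X φ τ (φ (j * τ) x) (transversalPoincareFlow X φ (j * τ) x u) := by
      simp only [hα]
      rw [e1, h.fieldCoord_add _ _ _ _ (hXne _ hy), add_sub_cancel_left]
    rw [e2]
    unfold fieldCoord
    have hXpos := norm_pos_iff.2 (hXne _ hy)
    rw [abs_div, abs_of_pos (pow_pos hXpos 2), div_le_iff₀ (pow_pos hXpos 2)]
    calc _ ≤ ‖X (φ τ (φ (j * τ) x))‖ * _ := abs_real_inner_le_norm _ _
      _ ≤ ‖X (φ τ (φ (j * τ) x))‖ * (C₁ * a j) := by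
        gcongr
        exact h₁ _ _
      _ = 1 * (‖X (φ τ (φ (j * τ) x))‖ * (C₁ * a j)) := (one_mul _).symm
      _ ≤ (C₂ * ‖X (φ τ (φ (j * τ) x))‖) * (‖X (φ τ (φ (j * τ) x))‖ * (C₁ * a j)) :=
        mul_le_mul_of_nonneg_right (h₂ _ hy).2 (by have := ha0 j; positivity)
      _ = _ := by ring
  obtain ⟨L, hL⟩ := exists_limit_of_decay hl1 (by positivity) hdecay hinc
  -- The lift is `u - L • X x`, with `L` the limit of the `X`-coordinates. Its image has transversal
  -- part `Φu` and an `X`-part of size `O(‖Φu‖)`, so its norm is comparable to `a j`.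
  have hv : ∀ j : ℤ, tangentFlow I φ (j * τ) x (u - L • X x) =
      transversalPoincareFlow X φ (j * τ) x u + (α j - L) • X (φ (j * τ) x) := by
    intro j
    rw [map_sub, map_smul, h.tangentFlow_field, transversalPoincareFlow_apply, sub_smul]
    abel
  have hlow : ∀ j : ℤ, a j ≤ ‖tangentFlow I φ (j * τ) x (u - L • X x)‖ := by
    intro j
    refine le_of_sq_le_sq ?_ (norm_nonneg _)
    rw [hv, norm_add_sq_real, inner_smul_right, real_inner_comm, inner_transversalPoincareFlow,
      mul_zero, mul_zero, add_zero]
    exact le_add_of_nonneg_right (sq_nonneg _)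
  have hup : ∀ j : ℤ, ‖tangentFlow I φ (j * τ) x (u - L • X x)‖ ≤ (1 + C₃ * C₂) * a j := by
    intro j
    rw [hv]
    refine (norm_add_le _ _).trans ?_
    rw [norm_smul, Real.norm_eq_abs]
    have e1 := mul_le_mul (hL j) (h₂ _ (hKφ (j * τ) x hx)).1 (norm_nonneg _)
      (by have := ha0 j; positivity)
    calc a j + _ ≤ a j + C₃ * a j * C₂ := add_le_add_right e1 _
      _ = _ := by ring
  refine ⟨u - L • X x, fun h0 ↦ hu0 ?_, ?_, fun j k ↦ ?_⟩
  · rw [sub_eq_zero] at h0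
    rw [h0, inner_smul_right, real_inner_self_eq_norm_sq, mul_eq_zero] at huX
    rcases huX with e | e
    · rw [h0, e, zero_smul]
    · exact absurd (pow_eq_zero_iff two_ne_zero |>.1 e) (norm_ne_zero_iff.2 (hXne x hx))
  · rw [map_sub, map_smul, huH, h.differential_field, smul_zero, sub_zero]
  · calc _ ≤ (1 + C₃ * C₂) * a (j + k) := hup _
      _ ≤ (1 + C₃ * C₂) * (b * l ^ k * a j) := by gcongr; exact hdecay j k
      _ ≤ (1 + C₃ * C₂) * (b * l ^ k * ‖tangentFlow I φ (j * τ) x (u - L • X x)‖) := by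
        gcongr; exact hlow j
      _ = _ := by ring

/-- With `B` and `l` fixed, all conditions on `v` are closed and homogeneous of degree one, so they
survive the limit of normalised vectors. -/
theorem exists_isContracted_of_mem_closure (h : IsHamiltonianFlow Ω H X φ) {Λ : Set M}
    {τ B l : ℝ} (hΛ : ∀ x ∈ Λ, ∃ v : TangentSpace I x, v ≠ 0 ∧ differential I H x v = 0 ∧
      IsContracted φ τ B l x v) {x : M} (hx : x ∈ closure Λ) :
    ∃ v : TangentSpace I x, v ≠ 0 ∧ differential I H x v = 0 ∧ IsContracted φ τ B l x v := by
  -- The index `none` encodes `dH(v) = 0` as `|Ω(X, v)| ≤ 0`; the pairs `(j, k)` encode the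
  -- contraction inequalities.
  let f : Option (ℤ × ℕ) → (x : M) → TangentSpace I x → ℝ := fun i x v ↦
    i.elim |Ω.form x (X x) v| fun p ↦ ‖tangentFlow I φ ((p.1 + p.2 : ℤ) * τ) x v‖ -
      B * l ^ p.2 * ‖tangentFlow I φ (p.1 * τ) x v‖
  have hc : ∀ t, FibreContinuous fun x v _ ↦ ‖tangentFlow I φ t x v‖ := fun t ↦
    (fibreContinuousVec_fst.map (h.continuous_tangentFlow t)).norm
  obtain ⟨v, hv, hvf⟩ := exists_ne_zero_of_mem_closure (f := f) (Λ := Λ) (x₀ := x)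
    (by
      rintro (_ | ⟨j, k⟩)
      · exact ((fibreContinuousVec_field (continuous_hamiltonianField h.contMDiff h.form_eq)
          continuous_id).form fibreContinuousVec_fst Ω).abs
      · exact (hc _).sub ((hc _).const_mul _))
    (by
      rintro (_ | ⟨j, k⟩) x v a
      · change |_| = |a| * |_|
        rw [map_smul, smul_eq_mul, abs_mul]
      · change ‖_‖ - _ * ‖_‖ = |a| * (‖_‖ - _ * ‖_‖)
        rw [map_smul, map_smul, norm_smul, norm_smul, Real.norm_eq_abs]
        ring)
    (by
      intro y hy
      obtain ⟨v, hv, hvH, hvc⟩ := hΛ y hy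
      refine ⟨v, hv, ?_⟩
      rintro (_ | ⟨j, k⟩)
      · change |Ω.form y (X y) v| ≤ 0
        rw [h.form_eq, hvH, abs_zero]
      · exact sub_nonpos.2 (hvc j k)) hx
  refine ⟨v, hv, ?_, fun j k ↦ sub_nonpos.1 (hvf (some (j, k)))⟩
  rw [← h.form_eq]
  exact abs_nonpos_iff.1 (hvf none)

end IsHamiltonianFlow

end Contraction

/-! ### The hyperbolic splitting over the closure -/

section Splitting

set_option linter.unusedSectionVars false

open Set Filter

variable {E : Type*} [NormedAddCommGroup E] [NormedSpace ℝ E] [FiniteDimensional ℝ E]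
  {A : Type*} [TopologicalSpace A] {I : ModelWithCorners ℝ E A}
  {M : Type*} [TopologicalSpace M] [ChartedSpace A M] [IsManifold I ∞ M]
  [T2Space M] [CompactSpace M]
  [RiemannianBundle (fun x : M ↦ TangentSpace I x)]
  [IsContinuousRiemannianBundle E (fun x : M ↦ TangentSpace I x)]
  {Ω : SymplecticForm I M} {H : M → ℝ} {X : (x : M) → TangentSpace I x} {φ : ℝ → M → M}

/-- The vectors of `ker dH(x)` that tend to zero at the positive integer multiples of `τ`. -/
def stableSpace (I : ModelWithCorners ℝ E A) {M : Type*} [TopologicalSpace M] [ChartedSpace A M]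
    [IsManifold I ∞ M] [RiemannianBundle (fun x : M ↦ TangentSpace I x)]
    (H : M → ℝ) (φ : ℝ → M → M) (τ : ℝ) (x : M) : Submodule ℝ (TangentSpace I x) where
  carrier := {v | differential I H x v = 0 ∧
    Tendsto (fun k : ℕ ↦ ‖tangentFlow I φ (k * τ) x v‖) atTop (𝓝 0)}
  zero_mem' := by simp
  add_mem' := by
    rintro v w ⟨hv, hv'⟩ ⟨hw, hw'⟩
    refine ⟨by rw [map_add, hv, hw, add_zero], ?_⟩
    refine squeeze_zero (fun k ↦ norm_nonneg _) (fun k ↦ ?_)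
      (by simpa only [add_zero] using hv'.add hw')
    rw [map_add]
    exact norm_add_le _ _
  smul_mem' := by
    rintro c v ⟨hv, hv'⟩
    refine ⟨by rw [map_smul, hv, smul_zero], ?_⟩
    simpa only [map_smul, norm_smul, mul_zero] using hv'.const_mul ‖c‖

namespace IsHamiltonianFlow

theorem norm_tangentFlow_comm (h : IsHamiltonianFlow Ω H X φ) (s t : ℝ) (x : M)
    (v : TangentSpace I x) : ‖tangentFlow I φ s (φ t x) (tangentFlow I φ t x v)‖ =
      ‖tangentFlow I φ t (φ s x) (tangentFlow I φ s x v)‖ := by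
  rw [← h.norm_tangentFlow_add, ← h.norm_tangentFlow_add, add_comm]

theorem exists_norm_le_norm_tangentFlow (h : IsHamiltonianFlow Ω H X φ) (t : ℝ) :
    ∃ C > 0, ∀ (x : M) (v : TangentSpace I x), ‖v‖ ≤ C * ‖tangentFlow I φ t x v‖ := by
  obtain ⟨C, hC, hb⟩ := h.exists_norm_tangentFlow_le (-t)
  refine ⟨C, hC, fun x v ↦ ?_⟩
  have h1 := hb _ (tangentFlow I φ t x v)
  rwa [← h.norm_tangentFlow_add, neg_add_cancel, h.norm_tangentFlow_zero] at h1

theorem tangentFlow_surjective (h : IsHamiltonianFlow Ω H X φ) (t : ℝ) (x : M) :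
    Function.Surjective (tangentFlow I φ t x) := by
  have : FiniteDimensional ℝ (TangentSpace I x) := inferInstanceAs (FiniteDimensional ℝ E)
  have : FiniteDimensional ℝ (TangentSpace I (φ t x)) := inferInstanceAs (FiniteDimensional ℝ E)
  have hfin : Module.finrank ℝ (TangentSpace I x) = Module.finrank ℝ (TangentSpace I (φ t x)) :=
    rfl
  exact (LinearMap.injective_iff_surjective_of_finrank_eq_finrank
    (f := (tangentFlow I φ t x).toLinearMap) hfin).1 (h.tangentFlow_injective t x)

/-- `Dφᵗ` commutes with the iterates and is bounded together with its inverse, so it preserves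
convergence to zero. -/
theorem map_stableSpace (h : IsHamiltonianFlow Ω H X φ) (τ t : ℝ) (x : M) :
    (stableSpace I H φ τ x).map (tangentFlow I φ t x).toLinearMap =
      stableSpace I H φ τ (φ t x) := by
  apply le_antisymm
  · rintro _ ⟨v, ⟨hvH, hv⟩, rfl⟩
    refine ⟨(h.differential_tangentFlow t x v).trans hvH, ?_⟩
    obtain ⟨C, -, hb⟩ := h.exists_norm_tangentFlow_le t
    refine squeeze_zero (fun k ↦ norm_nonneg _) (fun k ↦ ?_)
      (by simpa only [mul_zero] using hv.const_mul C)
    exact (h.norm_tangentFlow_comm _ t x v).trans_le (hb _ _)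
  · rintro w ⟨hwH, hw⟩
    obtain ⟨v, rfl⟩ := h.tangentFlow_surjective t x w
    refine ⟨v, ⟨(h.differential_tangentFlow t x v).symm.trans hwH, ?_⟩, rfl⟩
    obtain ⟨C, -, hb⟩ := h.exists_norm_le_norm_tangentFlow t
    refine squeeze_zero (fun k ↦ norm_nonneg _) (fun k ↦ ?_)
      (by simpa only [mul_zero] using hw.const_mul C)
    rw [h.norm_tangentFlow_comm]
    exact hb _ _

end IsHamiltonianFlow

namespace IsContracted

variable {τ τ' B l : ℝ} {x : M} {v w : TangentSpace I x}

theorem norm_le (hv : IsContracted φ τ B l x v) (h : IsHamiltonianFlow Ω H X φ) (k : ℕ) :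
    ‖tangentFlow I φ (k * τ) x v‖ ≤ B * l ^ k * ‖v‖ := by
  have h1 := hv 0 k
  rwa [Int.cast_zero, zero_mul, h.norm_tangentFlow_zero, zero_add, Int.cast_natCast] at h1

theorem tendsto (hv : IsContracted φ τ B l x v) (h : IsHamiltonianFlow Ω H X φ) (hl0 : 0 ≤ l)
    (hl1 : l < 1) : Tendsto (fun k : ℕ ↦ ‖tangentFlow I φ (k * τ) x v‖) atTop (𝓝 0) := by
  refine squeeze_zero (fun k ↦ norm_nonneg _) (hv.norm_le h) ?_
  simpa using ((tendsto_pow_atTop_nhds_zero_of_lt_one hl0 hl1).const_mul B).mul_const ‖v‖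

/-- A vector contracted in one time direction grows exponentially in the other, so no nonzero
multiple of it stays bounded there. -/
theorem eq_zero_of_bounded (hv : IsContracted φ τ' B l x v) (h : IsHamiltonianFlow Ω H X φ)
    (hl0 : 0 ≤ l) (hl1 : l < 1) (hB : 0 ≤ B) (hτ : τ' = -τ) (hv0 : v ≠ 0) {c D : ℝ}
    (hD : ∀ k : ℕ, ‖tangentFlow I φ (k * τ) x (c • v)‖ ≤ D) : c = 0 := by
  have h1 : ∀ k : ℕ, ‖c • v‖ ≤ B * l ^ k * D := by
    intro k
    -- Here negative indices in `IsContracted` are needed: the estimate runs from time `-k τ' = k τ`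
    -- to time `0`.
    have e1 := hv (-k) k
    have e2 : ((-k : ℤ) : ℝ) * τ' = k * τ := by rw [hτ]; push_cast; ring
    rw [neg_add_cancel, Int.cast_zero, zero_mul, h.norm_tangentFlow_zero, e2] at e1
    have e3 := hD k
    rw [map_smul, norm_smul] at e3
    rw [norm_smul]
    calc ‖c‖ * ‖v‖ ≤ ‖c‖ * (B * l ^ k * ‖tangentFlow I φ (k * τ) x v‖) := by gcongr
      _ = B * l ^ k * (‖c‖ * ‖tangentFlow I φ (k * τ) x v‖) := by ring
      _ ≤ _ := by gcongr
  have h2 : Tendsto (fun k : ℕ ↦ B * l ^ k * D) atTop (𝓝 0) := by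
    simpa using ((tendsto_pow_atTop_nhds_zero_of_lt_one hl0 hl1).const_mul B).mul_const D
  have h3 : ‖c • v‖ ≤ 0 := ge_of_tendsto' h2 h1
  exact (smul_eq_zero.1 (norm_le_zero_iff.1 h3)).resolve_right hv0

/-- A combination of a contracted vector, an expanded vector and the field that tends to zero is a
multiple of the contracted vector. -/
theorem coeff_eq_zero (hv : IsContracted φ τ B l x v) (hw : IsContracted φ τ' B l x w)
    (h : IsHamiltonianFlow Ω H X φ) (hl0 : 0 ≤ l) (hl1 : l < 1) (hB : 0 ≤ B) (hτ : τ' = -τ)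
    (hw0 : w ≠ 0) {C : ℝ} (hX : ∀ t, ‖X (φ t x)‖ ≤ C ∧ 1 ≤ C * ‖X (φ t x)‖) {a b c : ℝ}
    (hz : Tendsto (fun k : ℕ ↦ ‖tangentFlow I φ (k * τ) x (a • v + b • w + c • X x)‖) atTop
      (𝓝 0)) : b = 0 ∧ c = 0 := by
  have hav : Tendsto (fun k : ℕ ↦ ‖tangentFlow I φ (k * τ) x (a • v)‖) atTop (𝓝 0) := by
    simpa only [map_smul, norm_smul, mul_zero] using (hv.tendsto h hl0 hl1).const_mul ‖a‖
  have hsum : Tendsto (fun k : ℕ ↦ ‖tangentFlow I φ (k * τ) x (a • v + b • w + c • X x)‖ +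
      ‖tangentFlow I φ (k * τ) x (a • v)‖) atTop (𝓝 0) := by
    simpa only [add_zero] using hz.add hav
  -- Subtracting the decaying `v`-part and the bounded `X`-part shows that the forward orbit of `b •
  -- w` is bounded.
  have hb : b = 0 := by
    obtain ⟨D, hD⟩ := hsum.bddAbove_range
    refine hw.eq_zero_of_bounded h hl0 hl1 hB hτ hw0 (D := D + ‖c‖ * C) fun k ↦ ?_
    have e1 : b • w = (a • v + b • w + c • X x) - a • v - c • X x := by abel
    conv_lhs => rw [e1]
    rw [map_sub]
    refine (norm_sub_le _ _).trans (add_le_add ?_ ?_)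
    · rw [map_sub]
      exact (norm_sub_le _ _).trans (hD ⟨k, rfl⟩)
    · rw [map_smul, norm_smul, h.tangentFlow_field]
      exact mul_le_mul_of_nonneg_left (hX _).1 (norm_nonneg _)
  refine ⟨hb, ?_⟩
  subst hb
  -- What remains of the `X`-part tends to zero, but `‖X‖` is bounded below along the orbit.
  have h1 : ∀ k : ℕ, ‖c‖ ≤ C * (‖tangentFlow I φ (k * τ) x (a • v + (0 : ℝ) • w + c • X x)‖ +
      ‖tangentFlow I φ (k * τ) x (a • v)‖) := by
    intro k
    have hC : 0 ≤ C := (norm_nonneg _).trans (hX 0).1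
    have e1 : c • X x = (a • v + (0 : ℝ) • w + c • X x) - a • v := by
      rw [zero_smul, add_zero, add_sub_cancel_left]
    have e2 : ‖c‖ * ‖X (φ (k * τ) x)‖ =
        ‖tangentFlow I φ (k * τ) x ((a • v + (0 : ℝ) • w + c • X x) - a • v)‖ := by
      rw [← e1, map_smul, norm_smul, h.tangentFlow_field]
    calc ‖c‖ = ‖c‖ * 1 := (mul_one _).symm
      _ ≤ ‖c‖ * (C * ‖X (φ (k * τ) x)‖) := by gcongr; exact (hX _).2
      _ = C * (‖c‖ * ‖X (φ (k * τ) x)‖) := by ring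
      _ ≤ _ := by
        rw [e2, map_sub]
        gcongr
        exact norm_sub_le _ _
  have h2 : ‖c‖ ≤ 0 := ge_of_tendsto' (by simpa only [mul_zero] using hsum.const_mul C) h1
  exact norm_le_zero_iff.1 h2

theorem independent (hv : IsContracted φ τ B l x v) (hw : IsContracted φ τ' B l x w)
    (h : IsHamiltonianFlow Ω H X φ) (hl0 : 0 ≤ l) (hl1 : l < 1) (hB : 0 ≤ B) (hτ : τ' = -τ)
    (hv0 : v ≠ 0) (hw0 : w ≠ 0) {C : ℝ} (hX : ∀ t, ‖X (φ t x)‖ ≤ C ∧ 1 ≤ C * ‖X (φ t x)‖)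
    {a b c : ℝ} (hz : a • v + b • w + c • X x = 0) : a = 0 ∧ b = 0 ∧ c = 0 := by
  obtain ⟨hb, hc⟩ := hv.coeff_eq_zero hw h hl0 hl1 hB hτ hw0 hX (a := a) (b := b) (c := c)
    (by simp [hz])
  rw [hb, hc, zero_smul, zero_smul, add_zero, add_zero] at hz
  exact ⟨(smul_eq_zero.1 hz).resolve_right hv0, hb, hc⟩

/-- `v`, `w` and `X` are a basis of `ker dH`, and in a vector tending to zero the coefficients of
`w` and `X` vanish. So the contracted direction, obtained only as some limit, is unique and does not
depend on choices. -/
theorem stableSpace_eq_span (hE : Module.finrank ℝ E = 4) (hv : IsContracted φ τ B l x v)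
    (hw : IsContracted φ τ' B l x w) (h : IsHamiltonianFlow Ω H X φ) (hl0 : 0 ≤ l) (hl1 : l < 1)
    (hB : 0 ≤ B) (hτ : τ' = -τ) (hv0 : v ≠ 0) (hw0 : w ≠ 0) (hvH : differential I H x v = 0)
    (hwH : differential I H x w = 0) (hx : differential I H x ≠ 0) {C : ℝ}
    (hX : ∀ t, ‖X (φ t x)‖ ≤ C ∧ 1 ≤ C * ‖X (φ t x)‖) :
    stableSpace I H φ τ x = Submodule.span ℝ {v} := by
  apply le_antisymm
  · rintro z ⟨hzH, hz⟩
    have hl : (differential I H x).toLinearMap ≠ 0 := fun h0 ↦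
      hx (ContinuousLinearMap.ext fun v ↦ LinearMap.congr_fun h0 v)
    obtain ⟨a, b, c, habc⟩ : ∃ a b c : ℝ, z = a • v + b • w + c • X x :=
      exists_eq_of_mem_ker (V := TangentSpace I x) hE hl hvH hwH (h.differential_field x)
        (fun a b c ↦ hv.independent hw h hl0 hl1 hB hτ hv0 hw0 hX) hzH
    subst habc
    obtain ⟨rfl, rfl⟩ := hv.coeff_eq_zero hw h hl0 hl1 hB hτ hw0 hX hz
    rw [zero_smul, zero_smul, add_zero, add_zero]
    exact Submodule.smul_mem _ _ (Submodule.mem_span_singleton_self v)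
  · rw [Submodule.span_singleton_le_iff_mem]
    exact ⟨hvH, hv.tendsto h hl0 hl1⟩

theorem normOn_span_le (hv : IsContracted φ τ B l x v) (h : IsHamiltonianFlow Ω H X φ)
    (hl0 : 0 ≤ l) (hB : 0 ≤ B) (k : ℕ) :
    normOn (tangentFlow I φ (k * τ) x) (Submodule.span ℝ {v}) ≤ B * l ^ k := by
  refine ContinuousLinearMap.opNorm_le_bound _ (by positivity) ?_
  rintro ⟨z, hz⟩
  obtain ⟨c, rfl⟩ := Submodule.mem_span_singleton.1 hz
  change ‖tangentFlow I φ (k * τ) x (c • v)‖ ≤ _ * ‖c • v‖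
  rw [map_smul, norm_smul, norm_smul]
  calc _ ≤ ‖c‖ * (B * l ^ k * ‖v‖) := mul_le_mul_of_nonneg_left (hv.norm_le h k) (norm_nonneg c)
    _ = _ := by ring

end IsContracted

theorem IsInvariantSet.closure {Λ : Set M} (hΛ : IsInvariantSet φ Λ)
    (hφ : ∀ t, Continuous (φ t)) : IsInvariantSet φ (closure Λ) := fun t _ hx ↦
  map_mem_closure (hφ t) hx fun y hy ↦ hΛ t y hy

/-- The closure of an invariant set with a dominated splitting is hyperbolic if it lies in an energy
level and contains no critical points. -/
theorem IsDominatedSplitting.isHyperbolicSet_closure (hE : Module.finrank ℝ E = 4)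
    (h : IsHamiltonianFlow Ω H X φ) {Λ : Set M} {m : ℕ}
    {Nm Np : (x : M) → Submodule ℝ (TangentSpace I x)}
    (hD : IsDominatedSplitting H X φ Λ m Nm Np) {e : ℝ} (he : ∀ x ∈ closure Λ, H x = e)
    (hKH : ∀ x ∈ closure Λ, differential I H x ≠ 0) : IsHyperbolicSet H X φ (closure Λ) := by
  have hKφ := hD.invariant_set.closure h.continuous_flow
  refine ⟨isClosed_closure.isCompact, hKφ, ⟨e, he⟩, hKH, ?_⟩
  obtain ⟨B₀, hB₀⟩ := hD.exists_decay hE h hKφ hKH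
  obtain ⟨B₁, hB₁, h₁⟩ := h.exists_isContracted_of_decay isClosed_closure hKφ hKH (m : ℝ) B₀
  obtain ⟨B₂, hB₂, h₂⟩ := h.exists_isContracted_of_decay isClosed_closure hKφ hKH (-m : ℝ) B₀
  obtain ⟨C, -, hC⟩ := h.exists_norm_field_bounds isClosed_closure hKH
  set l := √(1 / 2 : ℝ)
  have hl1 : l < 1 := sqrt_half_lt_one
  have hl0 : 0 ≤ l := Real.sqrt_nonneg _
  set B := max B₁ B₂
  have hB : 0 ≤ B := hB₁.le.trans (le_max_left _ _)
  obtain ⟨k, hk⟩ : ∃ k : ℕ, B * l ^ k ≤ 1 / 2 := by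
    have h3 : Tendsto (fun k : ℕ ↦ B * l ^ k) atTop (𝓝 0) := by
      simpa using (tendsto_pow_atTop_nhds_zero_of_lt_one hl0 hl1).const_mul B
    exact (h3.eventually_le_const (by norm_num)).exists
  -- `k` iterates of time `m` absorb the constant `B`. The expanded space is the stable space for
  -- the reversed step `-m`.
  refine ⟨k * m, stableSpace I H φ (-m), stableSpace I H φ m, fun x hx ↦ ?_⟩
  have hmono : ∀ {τ B B'} {v : TangentSpace I x}, B ≤ B' →
      IsContracted φ τ B l x v → IsContracted φ τ B' l x v := fun hBB' hv j k ↦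
    (hv j k).trans (by gcongr)
  obtain ⟨v, hv0, hvH, hv⟩ := h.exists_isContracted_of_mem_closure (fun y hy ↦ by
    obtain ⟨u, hu, hu0, hu'⟩ := (hB₀ y hy).1
    exact h₁ y (subset_closure hy) u hu hu0 hu') hx
  obtain ⟨w, hw0, hwH, hw⟩ := h.exists_isContracted_of_mem_closure (fun y hy ↦ by
    obtain ⟨u, hu, hu0, hu'⟩ := (hB₀ y hy).2
    exact h₂ y (subset_closure hy) u hu hu0 hu') hx
  replace hv := hmono (le_max_left B₁ B₂) hv
  replace hw := hmono (le_max_right B₁ B₂) hw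
  have hX : ∀ t, ‖X (φ t x)‖ ≤ C ∧ 1 ≤ C * ‖X (φ t x)‖ := fun t ↦ hC _ (hKφ t x hx)
  have hEm := hv.stableSpace_eq_span hE hw h hl0 hl1 hB rfl hv0 hw0 hvH hwH (hKH x hx) hX
  have hEp := hw.stableSpace_eq_span hE hv h hl0 hl1 hB (neg_neg _).symm hw0 hv0 hwH hvH
    (hKH x hx) hX
  have hind : ∀ a b c : ℝ, a • v + b • w + c • X x = 0 → a = 0 ∧ b = 0 ∧ c = 0 := fun a b c ↦
    hv.independent hw h hl0 hl1 hB rfl hv0 hw0 hX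
  refine ⟨?_, ?_, ?_, fun t ↦ h.map_stableSpace _ t x, fun t ↦ h.map_stableSpace _ t x, ?_, ?_⟩
  · rw [hEp, hEm, Submodule.disjoint_def]
    intro z hzw hzv
    obtain ⟨b, rfl⟩ := Submodule.mem_span_singleton.1 hzw
    obtain ⟨a, ha⟩ := Submodule.mem_span_singleton.1 hzv
    obtain ⟨rfl, -, -⟩ := hind a (-b) 0 (by rw [ha, neg_smul, zero_smul]; abel)
    rw [← ha, zero_smul]
  · rw [hEp, hEm, Submodule.disjoint_def]
    intro z hz hzX
    obtain ⟨z₁, hz₁, z₂, hz₂, rfl⟩ := Submodule.mem_sup.1 hz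
    obtain ⟨b, rfl⟩ := Submodule.mem_span_singleton.1 hz₁
    obtain ⟨a, rfl⟩ := Submodule.mem_span_singleton.1 hz₂
    obtain ⟨c, hc⟩ := Submodule.mem_span_singleton.1 hzX
    obtain ⟨rfl, rfl, -⟩ := hind a b (-c) (by rw [neg_smul, hc]; abel)
    rw [zero_smul, zero_smul, add_zero]
  · rw [hEp, hEm]
    apply le_antisymm
    · refine sup_le (sup_le ?_ ?_) ?_ <;> rw [Submodule.span_singleton_le_iff_mem]
      exacts [hwH, hvH, h.differential_field x]
    · intro z hz
      have hl : (differential I H x).toLinearMap ≠ 0 := fun h0 ↦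
        hKH x hx (ContinuousLinearMap.ext fun v ↦ LinearMap.congr_fun h0 v)
      obtain ⟨a, b, c, rfl⟩ := exists_eq_of_mem_ker (V := TangentSpace I x) hE hl hvH hwH
        (h.differential_field x) hind hz
      refine Submodule.add_mem_sup ?_
        (Submodule.smul_mem _ _ (Submodule.mem_span_singleton_self _))
      rw [add_comm]
      exact Submodule.add_mem_sup (Submodule.smul_mem _ _ (Submodule.mem_span_singleton_self _))
        (Submodule.smul_mem _ _ (Submodule.mem_span_singleton_self _))
  · rw [hEm, Nat.cast_mul]
    exact (hv.normOn_span_le h hl0 hB k).trans hk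
  · rw [hEp, Nat.cast_mul, ← mul_neg]
    exact (hw.normOn_span_le h hl0 hB k).trans hk

end Splitting

end HamiltonianDynamics

end

theorem mainTheorem6
    {A : Type*} [TopologicalSpace A] (I : ModelWithCorners ℝ (EuclideanSpace ℝ (Fin 4)) A)
    (hI : HamiltonianDynamics.IsFourDimModel I)
    {M : Type*} [TopologicalSpace M] [T2Space M] [CompactSpace M] [ChartedSpace A M]
    [IsManifold I ∞ M]
    [Bundle.RiemannianBundle (fun x : M ↦ TangentSpace I x)]
    [IsContMDiffRiemannianBundle I ∞ (EuclideanSpace ℝ (Fin 4)) (fun x : M ↦ TangentSpace I x)]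
    (Ω : HamiltonianDynamics.SymplecticForm I M)
    (H : M → ℝ) (hH : HamiltonianDynamics.IsHamiltonian I H)
    (φ : ℝ → M → M)
    (hφ : HamiltonianDynamics.IsFlowOf (HamiltonianDynamics.hamiltonianVectorField Ω H) φ)
    (S : Set M) (hS : HamiltonianDynamics.IsRegularEnergySurface I H S)
    (Λ : Set M) (hΛS : Λ ⊆ S)
    (hΛ : HamiltonianDynamics.HasDominatedSplitting H
      (HamiltonianDynamics.hamiltonianVectorField Ω H) φ Λ) :
    HamiltonianDynamics.IsHyperbolicSet H
      (HamiltonianDynamics.hamiltonianVectorField Ω H) φ (closure Λ) := by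
  have hflow : HamiltonianDynamics.IsHamiltonianFlow Ω H
      (HamiltonianDynamics.hamiltonianVectorField Ω H) φ :=
    ⟨hH.1, HamiltonianDynamics.form_hamiltonianVectorField Ω H, hφ⟩
  have hcont : IsContinuousRiemannianBundle (EuclideanSpace ℝ (Fin 4))
      (fun x : M ↦ TangentSpace I x) := by
    obtain ⟨g, hg, hg'⟩ := ‹IsContMDiffRiemannianBundle I ∞ (EuclideanSpace ℝ (Fin 4))
      (fun x : M ↦ TangentSpace I x)›.exists_contMDiff
    exact ⟨g, hg.continuous, hg'⟩
  obtain ⟨e, he, x₀, -, rfl⟩ := hS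
  obtain ⟨m, Nm, Np, hD⟩ := hΛ
  -- Only the level set has to be closed, not its component: regularity is assumed on the whole
  -- level `H = e`.
  have hlevel : ∀ x ∈ closure Λ, H x = e := fun x hx ↦
    closure_minimal (hΛS.trans (connectedComponentIn_subset _ _))
      (isClosed_eq hH.1.continuous continuous_const) hx
  exact hD.isHyperbolicSet_closure (by simp) hflow hlevel fun x hx ↦ he x (hlevel x hx)
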